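/- Let $G$ be a finite connected graph, possibly with loops and multiple edges, containing at least one edge. A metric on $G$ is a function $\ell$ assigning to each edge $e$ of $G$ a length $\ell(e)\in(0,\infty)$; put $L(G,\ell)=\sum_{e}\ell(e)$, and identify each edge $e$ with the interval $[0,\ell(e)]$. Let $0=\lambda_0(G,\ell)<\lambda_1(G,\ell)\le\lambda_2(G,\ell)\le\cdots$ be the eigenvalues, repeated according to multiplicity, of the Laplacian with Neumann vertex conditions, i.e. of the problem of finding continuous functions $f\neq 0$ on $G$ such that $-f''=\lambda f$ over each edge and, at each vertex $v$, the derivatives of $f$ at $v$ in the directions away from $v$ into the incident edges sum up to zero (a loop at $v$ contributing two terms). For $j\ge 1$ let $\Lambda_j(G)$ be the smallest number such that $$\lambda_j(G,\ell)\le\frac{\Lambda_j(G)}{L(G,\ell)^2}\qquad\text{for all metrics }\ell\text{ on }G.$$ Let $p(G)$ be the number of pendant vertices of $G$ (vertices of degree one, where a loop counts twice), and let $\beta(G)=m(G)-n(G)+1$ be the Betti number of $G$, where $m(G)$ is the number of edges and $n(G)$ the number of vertices. Then for every $j\ge 1$, $$\Lambda_j(G)\le\Bigl(j-1+2\beta(G)+\frac{p(G)}{2}\Bigr)^2\pi^2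 .$$ -/

import Mathlib

open scoped Graph

noncomputable section

namespace Graph

variable {α β : Type*}

/-! ### Combinatorics of multigraphs (loops and multiple edges are allowed) -/

/-- A multigraph is connected if it has a vertex and any two vertices are joined by a walk. -/
def IsConnected (G : Graph α β) : Prop :=
  V(G).Nonempty ∧ ∀ u ∈ V(G), ∀ v ∈ V(G), Relation.ReflTransGen G.Adj u v

/-- The degree of a vertex of a finite multigraph: the number of incident edges, where a loop
counts twice. -/
def vertexDegree (G : Graph α β) (v : α) : ℕ :=
  (G.incidenceSet v).ncard + (G.loopSet v).ncard

/-- `p(G)`: the number of pendant vertices, that is, of vertices of degree one. -/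
def numPendant (G : Graph α β) : ℕ :=
  {v ∈ V(G) | G.vertexDegree v = 1}.ncard

/-- The Betti number `β(G) = m(G) - n(G) + 1` of a finite connected multigraph with `m(G)` edges
and `n(G)` vertices. -/
def betti (G : Graph α β) : ℤ :=
  (E(G).ncard : ℤ) - (V(G).ncard : ℤ) + 1

/-! ### Identification of the edges with intervals

A metric assigns a length `ℓ e > 0` to each edge `e`, and `e` is identified with `[0, ℓ e]`. For
this an initial and a terminal end of each edge are fixed once and for all. -/

theorem exists_ends (G : Graph α β) (e : E(G)) : ∃ p : α × α, G.IsLink (e : β) p.1 p.2 := by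
  obtain ⟨x, y, h⟩ := (G.edge_mem_iff_exists_isLink e).1 e.2
  exact ⟨(x, y), h⟩

/-- The end of `e` that is identified with `0`. -/
def source (G : Graph α β) (e : E(G)) : α := (G.exists_ends e).choose.1

/-- The end of `e` that is identified with `ℓ e`; it equals `G.source e` if `e` is a loop. -/
def target (G : Graph α β) (e : E(G)) : α := (G.exists_ends e).choose.2

theorem isLink_source_target (G : Graph α β) (e : E(G)) :
    G.IsLink (e : β) (G.source e) (G.target e) :=
  (G.exists_ends e).choose_spec

/-- `ℓ` is a metric on `G`: it assigns a positive (finite) length to each edge. -/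
def IsMetric (G : Graph α β) (ℓ : E(G) → ℝ) : Prop := ∀ e, 0 < ℓ e

/-- The total length `L(G, ℓ)`. -/
def totalLength (G : Graph α β) [Fintype E(G)] (ℓ : E(G) → ℝ) : ℝ := ∑ e, ℓ e

/-! ### The Laplacian with Neumann vertex conditions -/

open Classical in
/-- The function which is given on each edge `e ≃ [0, ℓ e]` by the restriction of `f e` to
`[0, ℓ e]` satisfies `-f'' = μ f` over each edge, is continuous at the vertices, and at each vertex
its derivatives in the directions away from that vertex into the incident edges sum up to zero (a
loop contributes two terms). The function `g e` is the derivative of `f e` on `[0, ℓ e]`, one-sided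
at the end points. The zero function is not excluded here. -/
def SolvesNeumann (G : Graph α β) [Fintype E(G)] (ℓ : E(G) → ℝ) (μ : ℝ)
    (f : E(G) → ℝ → ℝ) : Prop :=
  ∃ g : E(G) → ℝ → ℝ,
    (∀ e, ∀ x ∈ Set.Icc 0 (ℓ e), HasDerivWithinAt (f e) (g e x) (Set.Icc 0 (ℓ e)) x) ∧
    (∀ e, ∀ x ∈ Set.Icc 0 (ℓ e), HasDerivWithinAt (g e) (-(μ * f e x)) (Set.Icc 0 (ℓ e)) x) ∧
    (∃ φ : α → ℝ, ∀ e, f e 0 = φ (G.source e) ∧ f e (ℓ e) = φ (G.target e)) ∧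
    (∀ v ∈ V(G),
      ∑ e, ((if G.source e = v then g e 0 else 0) +
        (if G.target e = v then -(g e (ℓ e)) else 0)) = 0)

/-- There are at least `k` eigenvalues `μ ≤ c`, counted with multiplicity: there are `k` linearly
independent (as functions on the metric graph) solutions of the eigenvalue problem, each for some
`μ ≤ c`. -/
def HasEigenvaluesLE (G : Graph α β) [Fintype E(G)] (ℓ : E(G) → ℝ) (k : ℕ) (c : ℝ) : Prop :=
  ∃ f : Fin k → E(G) → ℝ → ℝ,
    LinearIndependent ℝ (fun i (e : E(G)) (x : Set.Icc 0 (ℓ e)) => f i e (x : ℝ)) ∧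
    ∀ i, ∃ μ ≤ c, G.SolvesNeumann ℓ μ (f i)

/-- The eigenvalue `λ_j(G, ℓ)` in `λ_0 ≤ λ_1 ≤ λ_2 ≤ …`, where each eigenvalue is repeated
according to its multiplicity: the least `c` such that at least `j + 1` eigenvalues, counted with
multiplicity, are `≤ c`. The infimum is taken in the extended reals; it would be `⊤` if there were
no such `c`. -/
def eigenvalue (G : Graph α β) [Fintype E(G)] (ℓ : E(G) → ℝ) (j : ℕ) : EReal :=
  sInf {c : EReal | ∃ r : ℝ, c = r ∧ G.HasEigenvaluesLE ℓ (j + 1) r}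

/-- `Λ_j(G)`: the smallest number such that `λ_j(G, ℓ) ≤ Λ_j(G) / L(G, ℓ)²` for all metrics `ℓ`
on `G`. The infimum is taken in the extended reals; it would be `⊤` if there were no such real
number. -/
def maxEigenvalue (G : Graph α β) [Fintype E(G)] (j : ℕ) : EReal :=
  sInf {C : EReal | ∀ ℓ : E(G) → ℝ, G.IsMetric ℓ →
    G.eigenvalue ℓ j ≤ C / ((G.totalLength ℓ ^ 2 : ℝ) : EReal)}

end Graph

end

/-! Fix `K > 0` with `K * L > π * (j - 1 + 2β + p/2)`; it is enough to find `j + 1` independent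
eigenfunctions with eigenvalues at most `K ^ 2`. Cut every edge into pieces shorter than `π / K`.
For `0 ≤ k ≤ K`, functions solving `-f'' = k² f` on each piece are determined by their node values,
and `∫ f'² - k² f²` becomes a symmetric matrix `networkOp` depending continuously on `k`. Its kernel
vectors are the eigenfunctions for `k²`. It is nonnegative at `k = 0`, so if it is nonpositive at `k
= K` on a space of dimension `d`, then `d` matrix eigenvalues pass through zero on the way
(`exists_kernel_vectors_of_nonpos_subspace`). Everything stays finite-dimensional.

The trial space at `K` comes from a wave `cos (· - θ e)` on each edge, with an independent amplitude
on each nodal interval. If the waves have `Φ` sign changes in all, continuity at the vertices leaves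
dimension at least `n - m + Φ`. The form is at most `-K` times the sum over vertices of `f(v)²`
times the sum of the tangents of the phases at the ends at `v` (`inner_networkOp_self_le`), so these
tangent sums should be nonnegative. All phases add up to `K * L - π * Φ`; hence `Φ` is large when
the phases are small.

At each vertex one end, pointing towards a root, is tuned to make the tangent sum barely positive;
the phases there then add up to about `(deg v - 2)⁺ * π / 2` at most (`exists_phases`). One end `a₀`
remains untuned: the end at a leaf, or an end of an edge off a spanning tree (`exists_isRanking`).
If its phase is negative, a Dirichlet condition at its vertex costs one dimension, but `Φ` is
correspondingly larger (`exists_nonpos_subspace_of_lt`). -/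

noncomputable section

/-! ### Dimension counts for common kernels of functionals. -/

section LinearAlgebra

open Module

theorem Submodule.exists_ne_zero_of_card_lt_finrank {F ι : Type*} [AddCommGroup F] [Module ℝ F]
    [FiniteDimensional ℝ F] [Fintype ι] (W : Submodule ℝ F) (f : ι → F →ₗ[ℝ] ℝ)
    (h : Fintype.card ι < finrank ℝ W) : ∃ x ∈ W, x ≠ 0 ∧ ∀ i, f i x = 0 := by
  have hker : LinearMap.ker ((LinearMap.pi f).comp W.subtype) ≠ ⊥ :=
    LinearMap.ker_ne_bot_of_finrank_lt (by simpa using h)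
  obtain ⟨x, hx, hx0⟩ := Submodule.exists_mem_ne_zero_of_ne_bot hker
  refine ⟨x, x.2, by simpa using hx0, fun i => ?_⟩
  exact congrFun (LinearMap.mem_ker.1 hx) i

theorem LinearMap.finrank_le_finrank_ker_pi_add_card {F ι : Type*} [AddCommGroup F] [Module ℝ F]
    [FiniteDimensional ℝ F] [Fintype ι] (f : ι → F →ₗ[ℝ] ℝ) :
    finrank ℝ F ≤ finrank ℝ (LinearMap.ker (LinearMap.pi f)) + Fintype.card ι := by
  have h1 := LinearMap.finrank_range_add_finrank_ker (LinearMap.pi f)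
  have h2 := Submodule.finrank_le (LinearMap.range (LinearMap.pi f))
  rw [Module.finrank_fintype_fun_eq_card] at h2
  omega

end LinearAlgebra

/-! ### Eigenvalue perturbation and spectral flow. -/

section SpectralFlow

open Module RealInnerProductSpace

variable {F : Type*} [NormedAddCommGroup F] [InnerProductSpace ℝ F] [FiniteDimensional ℝ F] {n : ℕ}

namespace LinearMap.IsSymmetric

theorem inner_apply_self_eq_sum {T : F →ₗ[ℝ] F} (hT : T.IsSymmetric) (hn : finrank ℝ F = n)
    (x : F) :
    ⟪T x, x⟫ = ∑ l, hT.eigenvalues hn l * (hT.eigenvectorBasis hn).repr x l ^ 2 := by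
  rw [← (hT.eigenvectorBasis hn).repr.inner_map_map, PiLp.inner_apply]
  refine Finset.sum_congr rfl fun l _ => ?_
  rw [hT.eigenvectorBasis_apply_self_apply]
  simp
  ring

theorem norm_sq_eq_sum {T : F →ₗ[ℝ] F} (hT : T.IsSymmetric) (hn : finrank ℝ F = n) (x : F) :
    ‖x‖ ^ 2 = ∑ l, (hT.eigenvectorBasis hn).repr x l ^ 2 := by
  rw [← (hT.eigenvectorBasis hn).repr.norm_map, EuclideanSpace.norm_sq_eq]
  simp

/-- One half of the Courant-Fischer principle. -/
theorem eigenvalues_le_of_forall_mem {T : F →ₗ[ℝ] F} (hT : T.IsSymmetric) (hn : finrank ℝ F = n)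
    (W : Submodule ℝ F) (i : Fin n) (hW : n ≤ finrank ℝ W + i) {c : ℝ}
    (h : ∀ x ∈ W, ⟪T x, x⟫ ≤ c * ‖x‖ ^ 2) : hT.eigenvalues hn i ≤ c := by
  -- Only `n - 1 - i` eigencoordinates lie beyond `i`, fewer than the dimension of `W`.
  obtain ⟨x, hxW, hx0, hx⟩ := W.exists_ne_zero_of_card_lt_finrank
    (fun l : Finset.Ioi i => (hT.eigenvectorBasis hn).toBasis.coord l.1)
    (by have := i.2; rw [Fintype.card_coe, Fin.card_Ioi]; omega)
  have h1 : hT.eigenvalues hn i * ‖x‖ ^ 2 ≤ ⟪T x, x⟫ := by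
    rw [hT.inner_apply_self_eq_sum hn, hT.norm_sq_eq_sum hn, Finset.mul_sum]
    refine Finset.sum_le_sum fun l _ => ?_
    rcases le_or_gt l i with hl | hl
    · exact mul_le_mul_of_nonneg_right (hT.eigenvalues_antitone hn hl) (sq_nonneg _)
    · have : (hT.eigenvectorBasis hn).repr x l = 0 := hx ⟨l, Finset.mem_Ioi.2 hl⟩
      simp [this]
  have h2 : 0 < ‖x‖ ^ 2 := by positivity
  exact le_of_mul_le_mul_right (h1.trans (h x hxW)) h2

/-- Weyl's monotonicity and perturbation estimate. -/
theorem eigenvalues_le_add {S T : F →ₗ[ℝ] F} (hS : S.IsSymmetric) (hT : T.IsSymmetric)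
    (hn : finrank ℝ F = n) {ε : ℝ} (h : ∀ x, ⟪S x, x⟫ ≤ ⟪T x, x⟫ + ε * ‖x‖ ^ 2) (i : Fin n) :
    hS.eigenvalues hn i ≤ hT.eigenvalues hn i + ε := by
  let f := fun l : Finset.Iio i => (hT.eigenvectorBasis hn).toBasis.coord l.1
  refine hS.eigenvalues_le_of_forall_mem hn (LinearMap.ker (LinearMap.pi f)) i ?_ fun x hx => ?_
  · have := LinearMap.finrank_le_finrank_ker_pi_add_card f
    rwa [Fintype.card_coe, Fin.card_Iio, hn] at this
  · refine (h x).trans ?_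
    rw [add_mul]
    gcongr
    rw [hT.inner_apply_self_eq_sum hn, hT.norm_sq_eq_sum hn, Finset.mul_sum]
    refine Finset.sum_le_sum fun l _ => ?_
    rcases le_or_gt i l with hl | hl
    · exact mul_le_mul_of_nonneg_right (hT.eigenvalues_antitone hn hl) (sq_nonneg _)
    · have : (hT.eigenvectorBasis hn).repr x l = 0 :=
        congrFun (LinearMap.mem_ker.1 hx) ⟨l, Finset.mem_Iio.2 hl⟩
      simp [this]

theorem abs_eigenvalues_sub_le {S T : F →L[ℝ] F} (hS : (S : F →ₗ[ℝ] F).IsSymmetric)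
    (hT : (T : F →ₗ[ℝ] F).IsSymmetric) (hn : finrank ℝ F = n) (i : Fin n) :
    |hS.eigenvalues hn i - hT.eigenvalues hn i| ≤ ‖S - T‖ := by
  have key : ∀ {A B : F →L[ℝ] F} (x : F), ⟪A x, x⟫ ≤ ⟪B x, x⟫ + ‖A - B‖ * ‖x‖ ^ 2 := by
    intro A B x
    have h1 : ⟪(A - B) x, x⟫ ≤ ‖A - B‖ * ‖x‖ ^ 2 := by
      refine (real_inner_le_norm _ _).trans ?_
      rw [sq, ← mul_assoc]
      gcongr
      exact (A - B).le_opNorm x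
    rw [_root_.sub_apply, inner_sub_left] at h1
    linarith
  rw [abs_sub_le_iff]
  constructor
  · have := hS.eigenvalues_le_add hT hn (ε := ‖S - T‖) (fun x => key x) i
    linarith
  · have := hT.eigenvalues_le_add hS hn (ε := ‖S - T‖)
      (fun x => by rw [norm_sub_rev]; exact key x) i
    linarith

end LinearMap.IsSymmetric

/-- Spectral flow: if a continuous family of symmetric operators is nonnegative at `0`, and at `K`
has a nonpositive subspace of dimension `d`, then on the way at least `d` eigenvalues vanish. -/
theorem exists_kernel_vectors_of_nonpos_subspace {K : ℝ} (hK : 0 ≤ K) {T : ℝ → F →L[ℝ] F}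
    (hT : ∀ k, (T k : F →ₗ[ℝ] F).IsSymmetric) (hcont : ContinuousOn T (Set.Icc 0 K))
    (h0 : ∀ x, 0 ≤ ⟪T 0 x, x⟫) (W : Submodule ℝ F) (hW : ∀ x ∈ W, ⟪T K x, x⟫ ≤ 0) {d : ℕ}
    (hd : d ≤ finrank ℝ W) :
    ∃ (k : Fin d → ℝ) (u : Fin d → F), (∀ i, k i ∈ Set.Icc 0 K) ∧ (∀ i, T (k i) (u i) = 0) ∧
      ∀ c, LinearIndependent ℝ (fun i : {i // k i = c} => u i) := by
  have hdn : d ≤ finrank ℝ F := hd.trans W.finrank_le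
  set n := finrank ℝ F with hn
  have hn' : finrank ℝ F = n := rfl
  -- Mathlib lists the eigenvalues in decreasing order, so these are the `d` smallest.
  let ι : Fin d → Fin n := fun i => ⟨n - d + i, by omega⟩
  have hι : Function.Injective ι := by
    intro i j hij
    have := congrArg Fin.val hij
    simp only [ι] at this
    ext
    omega
  have hzero : ∀ i : Fin d, ∃ k ∈ Set.Icc 0 K, (hT k).eigenvalues hn' (ι i) = 0 := by
    intro i
    have hc : ContinuousOn (fun k => (hT k).eigenvalues hn' (ι i)) (Set.Icc 0 K) := by
      rw [Metric.continuousOn_iff] at hcont ⊢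
      intro a ha ε hε
      obtain ⟨δ, hδ, H⟩ := hcont a ha ε hε
      refine ⟨δ, hδ, fun b hb hba => lt_of_le_of_lt ?_ (H b hb hba)⟩
      rw [Real.dist_eq, dist_eq_norm]
      exact LinearMap.IsSymmetric.abs_eigenvalues_sub_le _ _ _ _
    have hK' : (hT K).eigenvalues hn' (ι i) ≤ 0 :=
      (hT K).eigenvalues_le_of_forall_mem hn' W (ι i) (by simp only [ι]; omega)
        (by simpa using hW)
    have h0' : 0 ≤ (hT 0).eigenvalues hn' (ι i) :=
      eigenvalue_nonneg_of_nonneg ((hT 0).hasEigenvalue_eigenvalues hn' (ι i))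
        (fun x => by
          have := h0 x
          rw [real_inner_comm] at this
          simpa using this)
    obtain ⟨k, hk, hk0⟩ := intermediate_value_Icc' hK hc ⟨hK', h0'⟩
    exact ⟨k, hk, hk0⟩
  choose k hk hk0 using hzero
  refine ⟨k, fun i => (hT (k i)).eigenvectorBasis hn' (ι i), hk, fun i => ?_, fun c => ?_⟩
  · have := (hT (k i)).apply_eigenvectorBasis hn' (ι i)
    simp only [hk0, RCLike.ofReal_zero, zero_smul] at this
    exact this
  -- Vectors sharing the same parameter `c` are distinct members of one orthonormal eigenbasis.
  · have h1 : LinearIndependent ℝ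
        (fun i : {i // k i = c} => (hT c).eigenvectorBasis hn' (ι i)) :=
      ((hT c).eigenvectorBasis hn').orthonormal.linearIndependent.comp (fun i : {i // k i = c} => ι i)
        (hι.comp Subtype.val_injective)
    convert h1 using 1
    funext ⟨i, hi⟩
    subst hi
    rfl

end SpectralFlow

end

noncomputable section

/-! ### The sine solution, uniformly down to frequency zero. -/

section ScaledSine

open Real

/-- `sin (k x) / k`, extended by `x` to `k = 0`. -/
def scaledSin (k x : ℝ) : ℝ := x * sinc (k * x)

theorem mul_scaledSin (k x : ℝ) : k * scaledSin k x = sin (k * x) := by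
  unfold scaledSin
  rcases eq_or_ne (k * x) 0 with h | h
  · rw [h, ← mul_assoc, h]; simp
  · rw [sinc_of_ne_zero h, ← mul_assoc, mul_div_assoc', mul_div_cancel_left₀ _ h]

theorem scaledSin_zero_left (x : ℝ) : scaledSin 0 x = x := by simp [scaledSin]

@[simp] theorem scaledSin_zero_right (k : ℝ) : scaledSin k 0 = 0 := by simp [scaledSin]

theorem scaledSin_neg (k x : ℝ) : scaledSin k (-x) = -scaledSin k x := by
  simp [scaledSin]

theorem scaledSin_add (k x y : ℝ) :
    scaledSin k (x + y) = scaledSin k x * cos (k * y) + cos (k * x) * scaledSin k y := by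
  rcases eq_or_ne k 0 with rfl | hk
  · simp [scaledSin_zero_left]
  · apply mul_left_cancel₀ hk
    have : k * (scaledSin k x * cos (k * y) + cos (k * x) * scaledSin k y) =
      (k * scaledSin k x) * cos (k * y) + cos (k * x) * (k * scaledSin k y) := by ring
    rw [this, mul_scaledSin, mul_scaledSin, mul_scaledSin, mul_add, sin_add]

theorem scaledSin_sub (k x y : ℝ) :
    scaledSin k (x - y) = scaledSin k x * cos (k * y) - cos (k * x) * scaledSin k y := by
  rw [sub_eq_add_neg, scaledSin_add, scaledSin_neg, mul_neg, cos_neg]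
  ring

theorem hasDerivAt_scaledSin (k x : ℝ) : HasDerivAt (scaledSin k) (cos (k * x)) x := by
  rcases eq_or_ne k 0 with rfl | hk
  · have : scaledSin 0 = id := funext scaledSin_zero_left
    simpa [this] using hasDerivAt_id x
  · have h : scaledSin k = fun y => sin (k * y) / k := by
      funext y
      rw [← mul_scaledSin]
      field_simp
    rw [h]
    refine (((hasDerivAt_id x).const_mul k).sin.div_const k).congr_deriv ?_
    simp only [id_eq]
    field_simp

theorem scaledSin_pos {k x : ℝ} (hk : 0 ≤ k) (hx : 0 < x) (hkx : k * x < π) :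
    0 < scaledSin k x := by
  rcases hk.eq_or_lt with rfl | hk
  · rwa [scaledSin_zero_left]
  · have := sin_pos_of_pos_of_lt_pi (mul_pos hk hx) hkx
    rw [← mul_scaledSin] at this
    exact pos_of_mul_pos_right this hk.le

theorem continuous_scaledSin_left (x : ℝ) : Continuous fun k => scaledSin k x := by
  unfold scaledSin
  exact continuous_const.mul (continuous_sinc.comp (by fun_prop))

end ScaledSine

/-! ### Solutions on an edge in terms of two node values. -/

section EdgeSolution

open Real

/-- The solution of `-f'' = k² f` with `f 0 = a` and `f h = b`. -/
def edgeSol (k h a b x : ℝ) : ℝ := (a * scaledSin k (h - x) + b * scaledSin k x) / scaledSin k h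

/-- The derivative of `edgeSol k h a b`. -/
def edgeSolDeriv (k h a b x : ℝ) : ℝ :=
  (-(a * cos (k * (h - x))) + b * cos (k * x)) / scaledSin k h

theorem hasDerivAt_edgeSol (k h a b x : ℝ) :
    HasDerivAt (edgeSol k h a b) (edgeSolDeriv k h a b x) x := by
  have h1 : HasDerivAt (fun y => scaledSin k (h - y)) (-cos (k * (h - x))) x := by
    simpa using (hasDerivAt_scaledSin k (h - x)).comp_const_sub h x
  refine (((h1.const_mul a).add ((hasDerivAt_scaledSin k x).const_mul b)).div_const
    (scaledSin k h)).congr_deriv ?_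
  unfold edgeSolDeriv
  ring

theorem hasDerivAt_edgeSolDeriv (k h a b x : ℝ) :
    HasDerivAt (edgeSolDeriv k h a b) (-(k ^ 2 * edgeSol k h a b x)) x := by
  have h2 : HasDerivAt (fun y => cos (k * y)) (-(k * sin (k * x))) x := by
    refine ((hasDerivAt_id x).const_mul k).cos.congr_deriv ?_
    simp only [id_eq]; ring
  have h1 : HasDerivAt (fun y => cos (k * (h - y))) (k * sin (k * (h - x))) x := by
    refine (((hasDerivAt_id x).const_sub h).const_mul k).cos.congr_deriv ?_
    simp only [id_eq]; ring
  refine ((((h1.const_mul a).neg).add (h2.const_mul b)).div_const (scaledSin k h)).congr_deriv ?_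
  unfold edgeSol
  rw [← mul_scaledSin, ← mul_scaledSin]
  ring

theorem edgeSol_zero {k h a b : ℝ} (hS : scaledSin k h ≠ 0) : edgeSol k h a b 0 = a := by
  simp [edgeSol, hS]

theorem edgeSol_self {k h a b : ℝ} (hS : scaledSin k h ≠ 0) : edgeSol k h a b h = b := by
  simp [edgeSol, hS]

theorem edgeSol_sub (k h a b x : ℝ) (hS : scaledSin k h ≠ 0) :
    edgeSol k h a b (x - h) =
      edgeSol k h a b x * cos (k * h) - edgeSolDeriv k h a b x * scaledSin k h := by
  unfold edgeSol edgeSolDeriv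
  rw [show h - (x - h) = (h - x) + h by ring, scaledSin_add, scaledSin_sub k x h]
  field_simp
  ring

theorem edgeSol_add (k h a b x : ℝ) (hS : scaledSin k h ≠ 0) :
    edgeSol k h a b (x + h) =
      edgeSol k h a b x * cos (k * h) + edgeSolDeriv k h a b x * scaledSin k h := by
  unfold edgeSol edgeSolDeriv
  rw [show h - (x + h) = (h - x) - h by ring, scaledSin_add, scaledSin_sub]
  field_simp
  ring

end EdgeSolution

/-! ### The discretized form and its kernel. -/

section Network

open RealInnerProductSpace Real

variable {V E : Type*} (src tgt : E → V) (M : ℕ)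

/-- Each edge is divided into `M + 1` pieces; `subdivNode src tgt M e i` is the `i`-th of the
`M + 2` points on the edge `e`. -/
def subdivNode (e : E) (i : ℕ) : V ⊕ E × Fin M :=
  if i = 0 then .inl (src e) else if h : i - 1 < M then .inr (e, ⟨i - 1, h⟩) else .inl (tgt e)

@[simp] theorem subdivNode_zero (e : E) : subdivNode src tgt M e 0 = .inl (src e) := by
  simp [subdivNode]

@[simp] theorem subdivNode_last (e : E) : subdivNode src tgt M e (M + 1) = .inl (tgt e) := by
  simp [subdivNode]

theorem subdivNode_succ {i : ℕ} (e : E) (h : i < M) :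
    subdivNode src tgt M e (i + 1) = .inr (e, ⟨i, h⟩) := by
  simp [subdivNode, h]

variable [Fintype V] [Fintype E] [DecidableEq V] [DecidableEq E]

/-- The matrix unit at `(p, q)`, as an operator. -/
def matrixUnit {X : Type*} [Fintype X] [DecidableEq X] (p q : X) :
    EuclideanSpace ℝ X →L[ℝ] EuclideanSpace ℝ X :=
  (EuclideanSpace.proj q : EuclideanSpace ℝ X →L[ℝ] ℝ).smulRight (EuclideanSpace.single p 1)

theorem inner_matrixUnit {X : Type*} [Fintype X] [DecidableEq X] (p q : X)
    (x y : EuclideanSpace ℝ X) : ⟪matrixUnit p q x, y⟫ = x q * y p := by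
  simp [matrixUnit, inner_smul_left, EuclideanSpace.inner_single_left]

/-- The operator of the quadratic form `∫ f' ² - k² f ²` on the functions which satisfy
`-f'' = k² f` on each piece of each edge, parametrized by their values at the nodes. -/
def networkOp (h : E → ℝ) (k : ℝ) :
    EuclideanSpace ℝ (V ⊕ E × Fin M) →L[ℝ] EuclideanSpace ℝ (V ⊕ E × Fin M) :=
  ∑ e, ∑ i ∈ Finset.range (M + 1),
    ((cos (k * h e) / scaledSin k (h e)) •
        (matrixUnit (subdivNode src tgt M e i) (subdivNode src tgt M e i) +
          matrixUnit (subdivNode src tgt M e (i + 1)) (subdivNode src tgt M e (i + 1))) -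
      (scaledSin k (h e))⁻¹ •
        (matrixUnit (subdivNode src tgt M e i) (subdivNode src tgt M e (i + 1)) +
          matrixUnit (subdivNode src tgt M e (i + 1)) (subdivNode src tgt M e i)))

theorem inner_networkOp (h : E → ℝ) (k : ℝ) (x y : EuclideanSpace ℝ (V ⊕ E × Fin M)) :
    ⟪networkOp src tgt M h k x, y⟫ = ∑ e, ∑ i ∈ Finset.range (M + 1),
      ((cos (k * h e) / scaledSin k (h e)) *
          (x (subdivNode src tgt M e i) * y (subdivNode src tgt M e i) +
            x (subdivNode src tgt M e (i + 1)) * y (subdivNode src tgt M e (i + 1))) -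
        (scaledSin k (h e))⁻¹ *
          (x (subdivNode src tgt M e (i + 1)) * y (subdivNode src tgt M e i) +
            x (subdivNode src tgt M e i) * y (subdivNode src tgt M e (i + 1)))) := by
  simp only [networkOp, _root_.sum_apply, sum_inner, _root_.sub_apply, inner_sub_left,
    _root_.smul_apply, real_inner_smul_left, _root_.add_apply, inner_add_left, inner_matrixUnit]

theorem isSymmetric_networkOp (h : E → ℝ) (k : ℝ) :
    (networkOp src tgt M h k : EuclideanSpace ℝ (V ⊕ E × Fin M) →ₗ[ℝ] _).IsSymmetric := by
  intro x y
  refine Eq.trans (b := ⟪networkOp src tgt M h k y, x⟫) ?_ (real_inner_comm _ _)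
  change ⟪networkOp src tgt M h k x, y⟫ = _
  rw [inner_networkOp, inner_networkOp]
  refine Finset.sum_congr rfl fun e _ => Finset.sum_congr rfl fun i _ => ?_
  ring

theorem continuousOn_networkOp {h : E → ℝ} (hh : ∀ e, 0 < h e) {K : ℝ} (hK : ∀ e, K * h e < π) :
    ContinuousOn (networkOp src tgt M h) (Set.Icc 0 K) := by
  have hS : ∀ e, ∀ k ∈ Set.Icc 0 K, scaledSin k (h e) ≠ 0 := fun e k hk =>
    (scaledSin_pos hk.1 (hh e)
      ((mul_le_mul_of_nonneg_right hk.2 (hh e).le).trans_lt (hK e))).ne'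
  have hc : ∀ e, ContinuousOn (fun k => scaledSin k (h e)) (Set.Icc 0 K) := fun e =>
    (continuous_scaledSin_left _).continuousOn
  unfold networkOp
  refine continuousOn_finsetSum _ fun e _ => continuousOn_finsetSum _ fun i _ => ?_
  refine ((ContinuousOn.div (by fun_prop) (hc e) (hS e)).smul continuousOn_const).sub
    (((hc e).inv₀ (hS e)).smul continuousOn_const)

theorem networkOp_zero_nonneg {h : E → ℝ} (hh : ∀ e, 0 < h e)
    (x : EuclideanSpace ℝ (V ⊕ E × Fin M)) : 0 ≤ ⟪networkOp src tgt M h 0 x, x⟫ := by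
  rw [inner_networkOp]
  refine Finset.sum_nonneg fun e _ => Finset.sum_nonneg fun i _ => ?_
  rw [zero_mul, cos_zero, scaledSin_zero_left, one_div, ← mul_sub]
  refine mul_nonneg (inv_nonneg.2 (hh e).le) ?_
  nlinarith [sq_nonneg (x (subdivNode src tgt M e i) - x (subdivNode src tgt M e (i + 1)))]

variable {src tgt M} {h : E → ℝ} {k : ℝ} {u : EuclideanSpace ℝ (V ⊕ E × Fin M)}

theorem networkOp_kernel_weak (hu : networkOp src tgt M h k u = 0)
    (hS : ∀ e, scaledSin k (h e) ≠ 0) (y : EuclideanSpace ℝ (V ⊕ E × Fin M)) :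
    ∑ e, ((∑ i ∈ Finset.range (M + 1),
        ((cos (k * h e) * u (subdivNode src tgt M e i) - u (subdivNode src tgt M e (i + 1))) /
          scaledSin k (h e)) * y (subdivNode src tgt M e i)) +
      ∑ i ∈ Finset.range (M + 1),
        ((cos (k * h e) * u (subdivNode src tgt M e (i + 1)) - u (subdivNode src tgt M e i)) /
          scaledSin k (h e)) * y (subdivNode src tgt M e (i + 1))) = 0 := by
  have := inner_networkOp src tgt M h k u y
  rw [hu, inner_zero_left] at this
  rw [this]
  refine Finset.sum_congr rfl fun e _ => ?_
  rw [← Finset.sum_add_distrib]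
  refine Finset.sum_congr rfl fun i _ => ?_
  have := hS e
  field_simp
  ring

theorem networkOp_kernel_interior (hu : networkOp src tgt M h k u = 0)
    (hS : ∀ e, scaledSin k (h e) ≠ 0) (e : E) {i : ℕ} (hi : i < M) :
    u (subdivNode src tgt M e (i + 2)) =
      2 * cos (k * h e) * u (subdivNode src tgt M e (i + 1)) - u (subdivNode src tgt M e i) := by
  -- Only the two pieces meeting at this interior node see the test vector.
  have H := networkOp_kernel_weak hu hS (EuclideanSpace.single (.inr (e, ⟨i, hi⟩)) 1)
  have hy : ∀ e' i', i' < M + 2 →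
      (EuclideanSpace.single (.inr (e, ⟨i, hi⟩)) (1 : ℝ) : EuclideanSpace ℝ (V ⊕ E × Fin M))
        (subdivNode src tgt M e' i') = if i' = i + 1 then (if e' = e then 1 else 0) else 0 := by
    intro e' i' hi'
    rcases i' with _ | i'
    · simp
    · rcases Nat.lt_or_ge i' M with h' | h'
      · rw [subdivNode_succ src tgt M e' h']
        by_cases h1 : i' = i <;> by_cases h2 : e' = e <;> simp [h1, h2]
      · obtain rfl : i' = M := by omega
        simp
        omega
  have H2 : ∀ e', ((∑ i' ∈ Finset.range (M + 1),
        ((cos (k * h e') * u (subdivNode src tgt M e' i') - u (subdivNode src tgt M e' (i' + 1))) /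
          scaledSin k (h e')) * (EuclideanSpace.single (.inr (e, ⟨i, hi⟩)) (1 : ℝ) :
            EuclideanSpace ℝ (V ⊕ E × Fin M)) (subdivNode src tgt M e' i')) +
      ∑ i' ∈ Finset.range (M + 1),
        ((cos (k * h e') * u (subdivNode src tgt M e' (i' + 1)) - u (subdivNode src tgt M e' i')) /
          scaledSin k (h e')) * (EuclideanSpace.single (.inr (e, ⟨i, hi⟩)) (1 : ℝ) :
            EuclideanSpace ℝ (V ⊕ E × Fin M)) (subdivNode src tgt M e' (i' + 1))) =
      if e' = e then ((cos (k * h e) * u (subdivNode src tgt M e (i + 1)) -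
          u (subdivNode src tgt M e (i + 2))) / scaledSin k (h e)) +
        ((cos (k * h e) * u (subdivNode src tgt M e (i + 1)) - u (subdivNode src tgt M e i)) /
          scaledSin k (h e)) else 0 := by
    intro e'
    rw [Finset.sum_eq_single (i + 1), Finset.sum_eq_single i]
    · rw [hy _ _ (by omega), if_pos rfl]
      split_ifs with h1
      · subst h1; simp
      · simp
    · intro b hb hbi
      rw [hy _ _ (by have := Finset.mem_range.1 hb; omega), if_neg (by omega), mul_zero]
    · intro h1
      exact absurd (Finset.mem_range.2 (by omega)) h1
    · intro b hb hbi
      rw [hy _ _ (by have := Finset.mem_range.1 hb; omega), if_neg hbi, mul_zero]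
    · intro h1
      exact absurd (Finset.mem_range.2 (by omega)) h1
  rw [Finset.sum_congr rfl fun e' _ => H2 e', Finset.sum_ite_eq' Finset.univ e] at H
  simp only [Finset.mem_univ, if_true] at H
  have := hS e
  field_simp at H
  linarith

theorem networkOp_kernel_vertex (hu : networkOp src tgt M h k u = 0)
    (hS : ∀ e, scaledSin k (h e) ≠ 0) (v : V) :
    ∑ e, ((if src e = v then (cos (k * h e) * u (subdivNode src tgt M e 0) -
          u (subdivNode src tgt M e 1)) / scaledSin k (h e) else 0) +
      (if tgt e = v then (cos (k * h e) * u (subdivNode src tgt M e (M + 1)) -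
          u (subdivNode src tgt M e M)) / scaledSin k (h e) else 0)) = 0 := by
  have H := networkOp_kernel_weak hu hS (EuclideanSpace.single (.inl v) 1)
  have hy : ∀ e i, 0 < i → i < M + 1 →
      (EuclideanSpace.single (.inl v) (1 : ℝ) : EuclideanSpace ℝ (V ⊕ E × Fin M))
        (subdivNode src tgt M e i) = 0 := by
    intro e i h0 hi
    obtain ⟨i, rfl⟩ : ∃ i', i = i' + 1 := ⟨i - 1, by omega⟩
    rw [subdivNode_succ src tgt M e (by omega)]
    simp
  refine (Finset.sum_congr rfl fun e _ => ?_).trans H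
  rw [Finset.sum_eq_single 0, Finset.sum_eq_single M]
  · simp
  · intro b hb hbi
    rw [hy _ _ (by omega) (by have := Finset.mem_range.1 hb; omega), mul_zero]
  · intro h1
    exact absurd (Finset.mem_range.2 (by omega)) h1
  · intro b hb hbi
    rw [hy _ _ (by omega) (by have := Finset.mem_range.1 hb; omega), mul_zero]
  · intro h1
    exact absurd (Finset.mem_range.2 (by omega)) h1

/-- A kernel vector and a sampled solution satisfy the same three-term recurrence and agree at the
first two nodes. So the solution on the first piece continues smoothly along the whole edge. -/
theorem edgeSol_subdivNode (hu : networkOp src tgt M h k u = 0)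
    (hS : ∀ e, scaledSin k (h e) ≠ 0) (e : E) {i : ℕ} (hi : i ≤ M + 1) :
    edgeSol k (h e) (u (subdivNode src tgt M e 0)) (u (subdivNode src tgt M e 1)) (i * h e) =
      u (subdivNode src tgt M e i) := by
  induction i using Nat.twoStepInduction with
  | zero => simpa using edgeSol_zero (hS e)
  | one => simpa using edgeSol_self (hS e)
  | more i h0 h1 =>
    rw [networkOp_kernel_interior hu hS e (by omega), ← h0 (by omega), ← h1 (by omega)]
    have e1 : ((i + 2 : ℕ) : ℝ) * h e = ((i + 1 : ℕ) : ℝ) * h e + h e := by push_cast; ring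
    have e2 : (i : ℝ) * h e = ((i + 1 : ℕ) : ℝ) * h e - h e := by push_cast; ring
    rw [e1, e2, edgeSol_add _ _ _ _ _ (hS e), edgeSol_sub _ _ _ _ _ (hS e)]
    ring

end Network

end

noncomputable section

/-! ### Separating different eigenvalues. -/

section Independence

/-- Families of solutions of `-f'' = c f` on intervals: a vanishing linear combination splits into
its parts for the individual values of `c`. -/
theorem sum_filter_eq_zero_of_hasDerivWithinAt {ι : Type*} [Fintype ι] {ℓ : ℝ} (hℓ : 0 < ℓ)
    {f g : ι → ℝ → ℝ} {c : ι → ℝ}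
    (hf : ∀ i, ∀ x ∈ Set.Icc 0 ℓ, HasDerivWithinAt (f i) (g i x) (Set.Icc 0 ℓ) x)
    (hg : ∀ i, ∀ x ∈ Set.Icc 0 ℓ, HasDerivWithinAt (g i) (-(c i * f i x)) (Set.Icc 0 ℓ) x)
    (a : ι → ℝ) (ha : ∀ x ∈ Set.Icc 0 ℓ, ∑ i, a i * f i x = 0) (κ : ℝ) [DecidableEq ℝ] :
    ∀ x ∈ Set.Icc 0 ℓ, ∑ i with c i = κ, a i * f i x = 0 := by
  classical
  have hu : UniqueDiffOn ℝ (Set.Icc 0 ℓ) := uniqueDiffOn_Icc hℓ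
  have hzero : ∀ {F : ℝ → ℝ} {F' x : ℝ}, x ∈ Set.Icc 0 ℓ → (∀ y ∈ Set.Icc 0 ℓ, F y = 0) →
      HasDerivWithinAt F F' (Set.Icc 0 ℓ) x → F' = 0 := by
    intro F F' x hx h0 hF
    refine (hu x hx).eq_deriv _ hF ((hasDerivWithinAt_const x (Set.Icc 0 ℓ) (0 : ℝ)).congr h0 (h0 x hx))
  -- Differentiating a vanishing combination twice multiplies each coefficient by `-(c i)`.
  have step : ∀ b : ι → ℝ, (∀ x ∈ Set.Icc 0 ℓ, ∑ i, b i * f i x = 0) →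
      ∀ x ∈ Set.Icc 0 ℓ, ∑ i, (b i * c i) * f i x = 0 := by
    intro b hb x hx
    have h1 : ∀ y ∈ Set.Icc 0 ℓ, ∑ i, b i * g i y = 0 := fun y hy =>
      hzero hy hb (HasDerivWithinAt.fun_sum fun i _ => (hf i y hy).const_mul (b i))
    have h2 := hzero hx h1 (HasDerivWithinAt.fun_sum fun i _ => (hg i x hx).const_mul (b i))
    rw [← neg_eq_zero, ← h2, ← Finset.sum_neg_distrib]
    exact Finset.sum_congr rfl fun i _ => by ring
  have poly : ∀ p : Polynomial ℝ, ∀ x ∈ Set.Icc 0 ℓ, ∑ i, (a i * p.eval (c i)) * f i x = 0 := by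
    intro p
    induction p using Polynomial.induction_on' with
    | add p q hp hq =>
      intro x hx
      rw [← add_zero (0 : ℝ)]
      nth_rewrite 1 [← hp x hx]
      rw [← hq x hx, ← Finset.sum_add_distrib]
      refine Finset.sum_congr rfl fun i _ => ?_
      rw [Polynomial.eval_add]
      ring
    | monomial n r =>
      have hn : ∀ n : ℕ, ∀ x ∈ Set.Icc 0 ℓ, ∑ i, (a i * c i ^ n) * f i x = 0 := by
        intro n
        induction n with
        | zero => simpa using ha
        | succ n ih => simpa only [pow_succ, mul_assoc] using step _ ih
      intro x hx
      have := congrArg (r * ·) (hn n x hx)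
      simp only [Finset.mul_sum, mul_zero] at this
      rw [← this]
      refine Finset.sum_congr rfl fun i _ => ?_
      rw [Polynomial.eval_monomial]
      ring
  intro x hx
  -- The polynomial with roots at all values of `c` other than `κ` annihilates every unwanted term.
  let s : Finset ℝ := (Finset.univ.image c).erase κ
  have h := poly (∏ t ∈ s, (Polynomial.X - Polynomial.C t)) x hx
  have h0 : ∏ t ∈ s, (κ - t) ≠ 0 :=
    Finset.prod_ne_zero_iff.2 fun t ht => sub_ne_zero.2 (Finset.ne_of_mem_erase ht).symm
  have h1 : ∑ i, (a i * (∏ t ∈ s, (Polynomial.X - Polynomial.C t)).eval (c i)) * f i x =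
      (∏ t ∈ s, (κ - t)) * ∑ i with c i = κ, a i * f i x := by
    rw [Finset.mul_sum, Finset.sum_filter]
    refine Finset.sum_congr rfl fun i _ => ?_
    rw [Polynomial.eval_prod]
    simp only [Polynomial.eval_sub, Polynomial.eval_X, Polynomial.eval_C]
    split_ifs with hi
    · rw [hi]; ring
    · rw [Finset.prod_eq_zero (i := c i)
        (Finset.mem_erase.2 ⟨hi, Finset.mem_image_of_mem c (Finset.mem_univ i)⟩) (sub_self _)]
      ring
  rw [h1] at h
  exact (mul_eq_zero.1 h).resolve_left h0

end Independence

/-! ### From kernel vectors to eigenfunctions on the graph. -/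

namespace Graph

variable {α β : Type*} (G : Graph α β)

/-- `G.source` as a map into the vertex set. -/
def sourceVertex (e : E(G)) : V(G) := ⟨G.source e, (G.isLink_source_target e).left_mem⟩

/-- `G.target` as a map into the vertex set. -/
def targetVertex (e : E(G)) : V(G) := ⟨G.target e, (G.isLink_source_target e).right_mem⟩

variable {G} [Fintype V(G)] [Fintype E(G)] [DecidableEq V(G)] [DecidableEq E(G)] {M : ℕ}
  {h ℓ : E(G) → ℝ}

theorem solvesNeumann_of_networkOp_eq_zero (hℓ : ∀ e, ℓ e = (M + 1) * h e) {k : ℝ}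
    (hS : ∀ e, scaledSin k (h e) ≠ 0) {u : EuclideanSpace ℝ (V(G) ⊕ E(G) × Fin M)}
    (hu : networkOp G.sourceVertex G.targetVertex M h k u = 0) :
    G.SolvesNeumann ℓ (k ^ 2) fun e =>
      edgeSol k (h e) (u (subdivNode G.sourceVertex G.targetVertex M e 0))
        (u (subdivNode G.sourceVertex G.targetVertex M e 1)) := by
  classical
  have hend : ∀ e, edgeSol k (h e) (u (subdivNode G.sourceVertex G.targetVertex M e 0))
      (u (subdivNode G.sourceVertex G.targetVertex M e 1)) (ℓ e) =
        u (.inl (G.targetVertex e)) := by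
    intro e
    have := edgeSol_subdivNode hu hS e le_rfl
    rw [subdivNode_last] at this
    rw [hℓ, ← this]
    push_cast
    rfl
  refine ⟨fun e => edgeSolDeriv k (h e) (u (subdivNode G.sourceVertex G.targetVertex M e 0))
        (u (subdivNode G.sourceVertex G.targetVertex M e 1)),
    fun e x _ => (hasDerivAt_edgeSol _ _ _ _ _).hasDerivWithinAt,
    fun e x _ => (hasDerivAt_edgeSolDeriv _ _ _ _ _).hasDerivWithinAt,
    ⟨fun v => if hv : v ∈ V(G) then u (.inl ⟨v, hv⟩) else 0, fun e => ⟨?_, ?_⟩⟩, fun v hv => ?_⟩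
  · dsimp only
    rw [edgeSol_zero (hS e), subdivNode_zero, dif_pos (G.isLink_source_target e).left_mem]
    rfl
  · dsimp only
    rw [hend, dif_pos (G.isLink_source_target e).right_mem]
    rfl
  -- The kernel equation at a vertex is the negative of the sum of outgoing derivatives.
  · refine neg_eq_zero.1 (Eq.trans ?_ (networkOp_kernel_vertex hu hS ⟨v, hv⟩))
    rw [← Finset.sum_neg_distrib]
    refine Finset.sum_congr rfl fun e _ => ?_
    have h1 : G.sourceVertex e = ⟨v, hv⟩ ↔ G.source e = v := Subtype.ext_iff
    have h2 : G.targetVertex e = ⟨v, hv⟩ ↔ G.target e = v := Subtype.ext_iff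
    simp only [h1, h2]
    -- Stepping back from the far end expresses the derivative there by the last two node values.
    have hM := edgeSol_sub k (h e) (u (subdivNode G.sourceVertex G.targetVertex M e 0))
        (u (subdivNode G.sourceVertex G.targetVertex M e 1)) (ℓ e) (hS e)
    have e1 : ℓ e - h e = M * h e := by rw [hℓ]; ring
    rw [e1, edgeSol_subdivNode hu hS e M.le_succ, hend] at hM
    rw [neg_add]
    congr 1
    · split_ifs
      · unfold edgeSolDeriv
        simp only [sub_zero, mul_zero, Real.cos_zero, mul_one]
        ring
      · simp
    · split_ifs
      · rw [neg_neg, subdivNode_last, hM]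
        have := hS e
        field_simp
        ring
      · simp

theorem hasEigenvaluesLE_of_nonpos_subspace (hh : ∀ e, 0 < h e)
    (hℓ : ∀ e, ℓ e = (M + 1) * h e) {K : ℝ} (hK0 : 0 ≤ K) (hK : ∀ e, K * h e < Real.pi)
    (hends : ∀ v, ∃ e, G.sourceVertex e = v ∨ G.targetVertex e = v)
    (W : Submodule ℝ (EuclideanSpace ℝ (V(G) ⊕ E(G) × Fin M)))
    (hW : ∀ x ∈ W, inner ℝ (networkOp G.sourceVertex G.targetVertex M h K x) x ≤ 0) {d : ℕ}
    (hd : d ≤ Module.finrank ℝ W) : G.HasEigenvaluesLE ℓ d (K ^ 2) := by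
  classical
  obtain ⟨k, u, hk, hu, hind⟩ := exists_kernel_vectors_of_nonpos_subspace hK0
    (isSymmetric_networkOp G.sourceVertex G.targetVertex M h)
    (continuousOn_networkOp G.sourceVertex G.targetVertex M hh hK)
    (networkOp_zero_nonneg G.sourceVertex G.targetVertex M hh) W hW hd
  have hS : ∀ i e, scaledSin (k i) (h e) ≠ 0 := fun i e =>
    (scaledSin_pos (hk i).1 (hh e)
      ((mul_le_mul_of_nonneg_right (hk i).2 (hh e).le).trans_lt (hK e))).ne'
  set f : Fin d → E(G) → ℝ → ℝ := fun i e =>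
    edgeSol (k i) (h e) (u i (subdivNode G.sourceVertex G.targetVertex M e 0))
        (u i (subdivNode G.sourceVertex G.targetVertex M e 1)) with hf
  have hℓ0 : ∀ e, 0 < ℓ e := fun e => by
    rw [hℓ]
    have := hh e
    positivity
  refine ⟨f, ?_, fun i => ⟨k i ^ 2, pow_le_pow_left₀ (hk i).1 (hk i).2 2,
    solvesNeumann_of_networkOp_eq_zero hℓ (hS i) (hu i)⟩⟩
  rw [Fintype.linearIndependent_iff]
  intro a ha i₀
  have hfil : ∀ e, ∀ x ∈ Set.Icc 0 (ℓ e), ∑ i with k i ^ 2 = k i₀ ^ 2, a i * f i e x = 0 := by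
    intro e
    refine sum_filter_eq_zero_of_hasDerivWithinAt (hℓ0 e)
      (fun i x _ => (hasDerivAt_edgeSol _ _ _ _ _).hasDerivWithinAt)
      (fun i x _ => (hasDerivAt_edgeSolDeriv _ _ _ _ _).hasDerivWithinAt) a ?_ _
    intro x hx
    have := congrFun (congrFun ha e) ⟨x, hx⟩
    simp only [Finset.sum_apply, Pi.smul_apply, smul_eq_mul, Pi.zero_apply] at this
    exact this
  -- Restricting to the nodes turns the relation between functions into one between kernel vectors;
  -- since `k i ≥ 0`, equal squares mean equal `k i`.
  have hnode : ∀ e, ∀ m ≤ M + 1, ∑ i with k i = k i₀,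
      a i * u i (subdivNode G.sourceVertex G.targetVertex M e m) = 0 := by
    intro e m hm
    have h1 := hfil e (m * h e) ⟨mul_nonneg m.cast_nonneg (hh e).le, by
      rw [hℓ]
      have : (m : ℝ) ≤ M + 1 := by exact_mod_cast hm
      exact mul_le_mul_of_nonneg_right this (hh e).le⟩
    rw [← h1]
    refine Finset.sum_congr ?_ fun i _ => ?_
    · ext i
      simp only [Finset.mem_filter, Finset.mem_univ, true_and]
      exact (pow_left_inj₀ (hk i).1 (hk i₀).1 two_ne_zero).symm
    · rw [hf, ← edgeSol_subdivNode (hu i) (hS i) e hm]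
  have hall : ∀ p, ∑ i with k i = k i₀, a i * u i p = 0 := by
    rintro (v | ⟨e, m⟩)
    · obtain ⟨e, rfl | rfl⟩ := hends v
      · simpa using hnode e 0 (Nat.zero_le _)
      · simpa using hnode e (M + 1) le_rfl
    · simpa [subdivNode_succ _ _ M e m.2] using hnode e (m + 1) (by omega)
  have hsum : ∑ i : {i // k i = k i₀}, a i • u i = 0 := by
    ext p
    have hp := hall p
    rw [← Finset.sum_subtype_eq_sum_filter] at hp
    simpa using hp
  exact Fintype.linearIndependent_iff.1 (hind (k i₀)) (fun i => a i) hsum ⟨i₀, rfl⟩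

end Graph

end

noncomputable section

open Real

/-! ### Phases, sign changes and the form of one piece. -/

section Phase

/-- The number of sign changes of the values of `cos (· - θ)` at `0, η, …, N η`. -/
def signChanges (N : ℕ) (η θ : ℝ) : ℕ :=
  ((Finset.range N).filter fun i : ℕ => cos (i * η - θ) * cos ((i + 1 : ℕ) * η - θ) < 0).card

/-- `cos (· - θ)` does not vanish at `0, η, …, N η`, and `θ` is normalized. -/
def IsPhase (N : ℕ) (η θ : ℝ) : Prop :=
  |θ| < π / 2 ∧ ∀ i : ℕ, i ≤ N → cos (i * η - θ) ≠ 0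

/-- The phase of `cos (· - θ)` seen from the point `N η`. -/
def oppositePhase (N : ℕ) (η θ : ℝ) : ℝ := N * η - θ - signChanges N η θ * π

/-- Each step advances the phase by less than `π`, so it passes `π / 2` at most once, precisely when
a sign change is counted; subtracting `π` then normalizes it again. -/
theorem abs_oppositePhase_lt {N : ℕ} {η θ : ℝ} (hη : 0 < η) (hηπ : η < π) (h : IsPhase N η θ) :
    |oppositePhase N η θ| < π / 2 := by
  obtain ⟨hθ, hN⟩ := h
  induction N with
  | zero => simpa [oppositePhase, signChanges] using hθ
  | succ N ih =>
    specialize ih fun i hi => hN i (hi.trans N.le_succ)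
    set ψ := oppositePhase N η θ with hψ
    have h1 : (N : ℝ) * η - θ = ψ + signChanges N η θ * π := by rw [hψ, oppositePhase]; ring
    have h2 : ((N + 1 : ℕ) : ℝ) * η - θ = ψ + η + signChanges N η θ * π := by
      push_cast; linarith
    have hs : ∀ m : ℕ, ((-1 : ℝ) ^ m) * (-1) ^ m = 1 := fun m => by
      rw [← mul_pow]; simp
    have h3 : cos (N * η - θ) * cos ((N + 1 : ℕ) * η - θ) = cos ψ * cos (ψ + η) := by
      rw [h1, h2, cos_add_nat_mul_pi, cos_add_nat_mul_pi]
      linear_combination (cos ψ * cos (ψ + η)) * hs (signChanges N η θ)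
    have h4 : cos (ψ + η) ≠ 0 := by
      intro h0
      apply hN (N + 1) le_rfl
      rw [h2, cos_add_nat_mul_pi, h0, mul_zero]
    have h5 : 0 < cos ψ := cos_pos_of_mem_Ioo (abs_lt.1 ih)
    rw [abs_lt] at ih
    unfold oppositePhase signChanges
    rw [Finset.range_add_one, Finset.filter_insert, h3]
    rcases lt_trichotomy (ψ + η) (π / 2) with h6 | h6 | h6
    · have : 0 < cos (ψ + η) := cos_pos_of_mem_Ioo ⟨by linarith, h6⟩
      rw [if_neg (mul_pos h5 this).le.not_gt, h2, abs_lt]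
      change -(π / 2) < ψ + η + signChanges N η θ * π - signChanges N η θ * π ∧
        ψ + η + signChanges N η θ * π - signChanges N η θ * π < π / 2
      constructor <;> linarith
    · rw [h6, cos_pi_div_two] at h4
      exact absurd rfl h4
    · have : cos (ψ + η) < 0 := cos_neg_of_pi_div_two_lt_of_lt h6 (by linarith)
      rw [if_pos (mul_neg_of_pos_of_neg h5 this), Finset.card_insert_of_notMem (by simp), h2,
        abs_lt]
      change -(π / 2) < ψ + η + signChanges N η θ * π - ((signChanges N η θ + 1 : ℕ) : ℝ) * π ∧
        ψ + η + signChanges N η θ * π - ((signChanges N η θ + 1 : ℕ) : ℝ) * π < π / 2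
      push_cast
      constructor <;> linarith

theorem tan_oppositePhase (N : ℕ) (η θ : ℝ) : tan (oppositePhase N η θ) = tan (N * η - θ) :=
  tan_sub_nat_mul_pi _ _

/-- The quadratic form of a piece, in terms of a solution without zeros at the ends. -/
theorem piece_form_eq {K h φ a b : ℝ} (hS : scaledSin K h ≠ 0) (hp : cos φ ≠ 0)
    (hr : cos (φ + K * h) ≠ 0) :
    (cos (K * h) / scaledSin K h) * (a * a + b * b) - (scaledSin K h)⁻¹ * (b * a + a * b) =
      K * tan φ * a ^ 2 - K * tan (φ + K * h) * b ^ 2 +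
        (cos (φ + K * h) * a - cos φ * b) ^ 2 /
          (scaledSin K h * (cos φ * cos (φ + K * h))) := by
  have hK := mul_scaledSin K h
  have e1 : K * tan φ = (cos (K * h) - cos (φ + K * h) / cos φ) / scaledSin K h := by
    rw [tan_eq_sin_div_cos, eq_div_iff hS]
    field_simp
    rw [cos_add]
    linear_combination sin φ * hK
  have e2 : K * tan (φ + K * h) = (cos φ / cos (φ + K * h) - cos (K * h)) / scaledSin K h := by
    have e3 : cos φ = cos (φ + K * h) * cos (K * h) + sin (φ + K * h) * sin (K * h) := by
      rw [← cos_sub]; congr 1; ring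
    rw [tan_eq_sin_div_cos, eq_div_iff hS]
    field_simp
    linear_combination sin (φ + K * h) * hK - e3
  rw [e1, e2]
  field_simp
  ring

end Phase

/-! ### The trial space and its dimension. -/

section TrialSpace

open RealInnerProductSpace

variable {V E : Type*} (src tgt : E → V) (M : ℕ)

/-- The vertex at an end of an edge. -/
def endVertex (a : E × Bool) : V := if a.2 then tgt a.1 else src a.1

/-- The phase of `cos (· - θ e)` at an end of `e`, seen from this end. -/
def endPhase (N : ℕ) (η θ : E → ℝ) (a : E × Bool) : ℝ :=
  if a.2 then oppositePhase N (η a.1) (θ a.1) else θ a.1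

variable [Fintype V] [Fintype E] [DecidableEq V] [DecidableEq E]

variable {src tgt M}

/-- By `piece_form_eq` each piece contributes a difference of tangent terms plus a square over a
signed denominator. The square vanishes when the values are proportional to the wave, and its term
is nonpositive across a sign change, so no condition is needed there. The differences telescope
along the edge. -/
theorem inner_networkOp_self_le {h : E → ℝ} (hh : ∀ e, 0 < h e) {K : ℝ} (hK0 : 0 < K)
    (hK : ∀ e, K * h e < π) {θ : E → ℝ} (hθ : ∀ e, IsPhase (M + 1) (K * h e) (θ e))
    {x : EuclideanSpace ℝ (V ⊕ E × Fin M)}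
    (hx : ∀ e, ∀ i ∈ Finset.range (M + 1),
      ¬ cos (i * (K * h e) - θ e) * cos ((i + 1 : ℕ) * (K * h e) - θ e) < 0 →
      cos ((i + 1 : ℕ) * (K * h e) - θ e) * x (subdivNode src tgt M e i) =
        cos (i * (K * h e) - θ e) * x (subdivNode src tgt M e (i + 1))) :
    ⟪networkOp src tgt M h K x, x⟫ ≤ -(K * ∑ v : V, (∑ a : E × Bool with endVertex src tgt a = v,
      tan (endPhase (M + 1) (fun e => K * h e) θ a)) * x (.inl v) ^ 2) := by
  have hS : ∀ e, 0 < scaledSin K (h e) := fun e => scaledSin_pos hK0.le (hh e) (hK e)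
  have hsum : ∑ v : V, (∑ a : E × Bool with endVertex src tgt a = v,
      tan (endPhase (M + 1) (fun e => K * h e) θ a)) * x (.inl v) ^ 2 =
      ∑ e, (tan (θ e) * x (.inl (src e)) ^ 2 +
        tan ((M + 1 : ℕ) * (K * h e) - θ e) * x (.inl (tgt e)) ^ 2) := by
    have h1 : ∀ v : V, (∑ a : E × Bool with endVertex src tgt a = v,
        tan (endPhase (M + 1) (fun e => K * h e) θ a)) * x (.inl v) ^ 2 =
        ∑ a : E × Bool with endVertex src tgt a = v,
          tan (endPhase (M + 1) (fun e => K * h e) θ a) * x (.inl (endVertex src tgt a)) ^ 2 := by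
      intro v
      rw [Finset.sum_mul]
      refine Finset.sum_congr rfl fun a ha => ?_
      rw [(Finset.mem_filter.1 ha).2]
    rw [Finset.sum_congr rfl fun v _ => h1 v, Finset.sum_fiberwise, Fintype.sum_prod_type]
    refine Finset.sum_congr rfl fun e _ => ?_
    simp only [Fintype.sum_bool, endPhase, endVertex, if_true, Bool.false_eq_true, if_false,
      tan_oppositePhase]
    ring
  rw [hsum, inner_networkOp, Finset.mul_sum, ← Finset.sum_neg_distrib]
  refine Finset.sum_le_sum fun e _ => ?_
  set y : ℕ → ℝ := fun i => K * tan (i * (K * h e) - θ e) * x (subdivNode src tgt M e i) ^ 2 with hy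
  have hpiece : ∀ i ∈ Finset.range (M + 1),
      (cos (K * h e) / scaledSin K (h e)) *
          (x (subdivNode src tgt M e i) * x (subdivNode src tgt M e i) +
            x (subdivNode src tgt M e (i + 1)) * x (subdivNode src tgt M e (i + 1))) -
        (scaledSin K (h e))⁻¹ *
          (x (subdivNode src tgt M e (i + 1)) * x (subdivNode src tgt M e i) +
            x (subdivNode src tgt M e i) * x (subdivNode src tgt M e (i + 1))) ≤ y i - y (i + 1) := by
    intro i hi
    have e1 : ((i + 1 : ℕ) : ℝ) * (K * h e) - θ e = i * (K * h e) - θ e + K * h e := by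
      push_cast; ring
    have hp := (hθ e).2 i (Finset.mem_range.1 hi).le
    have hr := (hθ e).2 (i + 1) (Finset.mem_range.1 hi)
    have hxi := hx e i hi
    simp only [hy]
    rw [e1] at hr hxi ⊢
    rw [piece_form_eq (hS e).ne' hp hr]
    refine add_le_of_nonpos_right ?_
    by_cases hneg : cos (i * (K * h e) - θ e) * cos (i * (K * h e) - θ e + K * h e) < 0
    · exact div_nonpos_of_nonneg_of_nonpos (sq_nonneg _)
        (mul_nonpos_of_nonneg_of_nonpos (hS e).le hneg.le)
    · rw [hxi hneg, sub_self]
      simp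
  refine (Finset.sum_le_sum hpiece).trans ?_
  rw [Finset.sum_range_sub']
  simp only [hy, subdivNode_zero, subdivNode_last, Nat.cast_zero, zero_mul, zero_sub, tan_neg]
  apply le_of_eq
  ring

/-- The space of trial functions which are multiples of `cos (· - θ e)` on the nodal intervals. -/
theorem exists_nonpos_subspace {h : E → ℝ} (hh : ∀ e, 0 < h e) {K : ℝ} (hK0 : 0 < K)
    (hK : ∀ e, K * h e < π) {θ : E → ℝ} (hθ : ∀ e, IsPhase (M + 1) (K * h e) (θ e))
    (R : Finset V) (hR : ∀ v ∉ R, 0 ≤ ∑ a : E × Bool with endVertex src tgt a = v,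
      tan (endPhase (M + 1) (fun e => K * h e) θ a)) :
    ∃ W : Submodule ℝ (EuclideanSpace ℝ (V ⊕ E × Fin M)),
      (∀ x ∈ W, ⟪networkOp src tgt M h K x, x⟫ ≤ 0) ∧
      Fintype.card V + ∑ e, signChanges (M + 1) (K * h e) (θ e) ≤
        Module.finrank ℝ W + Fintype.card E + R.card := by
  -- Pieces without a sign change; each imposes one proportionality condition.
  let s : E → Finset ℕ := fun e => (Finset.range (M + 1)).filter fun i : ℕ =>
    ¬ cos (i * (K * h e) - θ e) * cos ((i + 1 : ℕ) * (K * h e) - θ e) < 0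
  let ι := Σ e, s e
  let f : ι ⊕ R → EuclideanSpace ℝ (V ⊕ E × Fin M) →ₗ[ℝ] ℝ := Sum.elim
    (fun p => cos ((p.2.1 + 1 : ℕ) * (K * h p.1) - θ p.1) •
        (EuclideanSpace.proj (subdivNode src tgt M p.1 p.2.1) :
          EuclideanSpace ℝ (V ⊕ E × Fin M) →L[ℝ] ℝ).toLinearMap -
      cos ((p.2.1 : ℕ) * (K * h p.1) - θ p.1) •
        (EuclideanSpace.proj (subdivNode src tgt M p.1 (p.2.1 + 1)) :
          EuclideanSpace ℝ (V ⊕ E × Fin M) →L[ℝ] ℝ).toLinearMap)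
    (fun v => (EuclideanSpace.proj (.inl v.1) :
          EuclideanSpace ℝ (V ⊕ E × Fin M) →L[ℝ] ℝ).toLinearMap)
  refine ⟨LinearMap.ker (LinearMap.pi f), fun x hx => ?_, ?_⟩
  · have hfx : ∀ p, f p x = 0 := fun p => congrFun (LinearMap.mem_ker.1 hx) p
    refine (inner_networkOp_self_le hh hK0 hK hθ fun e i hi hneg => ?_).trans ?_
    · have := hfx (.inl ⟨e, i, Finset.mem_filter.2 ⟨hi, hneg⟩⟩)
      simpa [f, sub_eq_zero] using this
    · rw [neg_nonpos]
      refine mul_nonneg hK0.le (Finset.sum_nonneg fun v _ => ?_)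
      by_cases hv : v ∈ R
      · have : x (.inl v) = 0 := hfx (.inr ⟨v, hv⟩)
        simp [this]
      · exact mul_nonneg (hR v hv) (sq_nonneg _)
  · have h1 := LinearMap.finrank_le_finrank_ker_pi_add_card f
    -- An edge has `M` interior nodes but `M + 1` pieces, so its net contribution to the dimension
    -- is its number of sign changes minus one.
    have h2 : ∀ e, Fintype.card (s e) + signChanges (M + 1) (K * h e) (θ e) = M + 1 := by
      intro e
      rw [Fintype.card_coe, add_comm]
      unfold signChanges
      rw [Finset.card_filter_add_card_filter_not, Finset.card_range]
    have h3 : Fintype.card ι + ∑ e, signChanges (M + 1) (K * h e) (θ e) =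
        Fintype.card E * (M + 1) := by
      rw [Fintype.card_sigma, ← Finset.sum_add_distrib, Finset.sum_congr rfl fun e _ => h2 e]
      simp
    rw [finrank_euclideanSpace, Fintype.card_sum, Fintype.card_prod, Fintype.card_fin,
      Fintype.card_sum, Fintype.card_coe] at h1
    rw [mul_add] at h3
    omega

end TrialSpace

end

noncomputable section

open Real

/-! ### Generic phases, reversal of edges, and arctangent sums. -/

section Phase

theorem exists_isPhase_mem_Ioo (N : ℕ) (η : ℝ) {lo hi : ℝ} (h : lo < hi) (hlo : -(π / 2) ≤ lo)
    (hhi : hi ≤ π / 2) : ∃ a ∈ Set.Ioo lo hi, IsPhase N η a := by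
  -- The shifts for which some node is a zero of the cosine form a countable set.
  have hc : (⋃ i : ℕ, Set.range fun n : ℤ => i * η - (2 * n + 1) * π / 2).Countable :=
    Set.countable_iUnion fun i => Set.countable_range _
  obtain ⟨a, ha, hlt, hgt⟩ := (hc.dense_compl ℝ).exists_between h
  refine ⟨a, ⟨hlt, hgt⟩, abs_lt.2 ⟨by linarith, by linarith⟩, fun i _ h0 => ha ?_⟩
  obtain ⟨n, hn⟩ := cos_eq_zero_iff.1 h0
  exact Set.mem_iUnion.2 ⟨i, n, by simp only; linarith⟩

theorem IsPhase.oppositePhase {N : ℕ} {η θ : ℝ} (hη : 0 < η) (hηπ : η < π) (h : IsPhase N η θ) :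
    IsPhase N η (oppositePhase N η θ) := by
  refine ⟨abs_oppositePhase_lt hη hηπ h, fun i hi h0 => h.2 (N - i) (Nat.sub_le _ _) ?_⟩
  have e1 : (i : ℝ) * η - _root_.oppositePhase N η θ =
      -(((N - i : ℕ) : ℝ) * η - θ) + signChanges N η θ * π := by
    rw [Nat.cast_sub hi, _root_.oppositePhase]; ring
  rw [e1, cos_add_nat_mul_pi, cos_neg] at h0
  exact (mul_eq_zero.1 h0).resolve_left (pow_ne_zero _ (by norm_num))

theorem oppositePhase_oppositePhase {N : ℕ} {η θ : ℝ} (hη : 0 < η) (hηπ : η < π)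
    (h : IsPhase N η θ) : oppositePhase N η (oppositePhase N η θ) = θ := by
  have h1 := abs_lt.1 (abs_oppositePhase_lt hη hηπ (h.oppositePhase hη hηπ))
  have h2 := abs_lt.1 h.1
  -- The two phases differ by a multiple of `π` and both lie in `(-π/2, π/2)`.
  have e1 : oppositePhase N η (oppositePhase N η θ) =
      θ + (((signChanges N η θ : ℤ) - signChanges N η (oppositePhase N η θ) : ℤ) : ℝ) * π := by
    conv_lhs => rw [oppositePhase]
    nth_rewrite 1 [oppositePhase]
    push_cast
    ring
  rw [e1] at h1
  set m : ℤ := (signChanges N η θ : ℤ) - signChanges N η (oppositePhase N η θ)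
  have hm1 : (m : ℝ) < 1 := by
    by_contra! hm
    nlinarith [pi_pos]
  have hm2 : (-1 : ℝ) < m := by
    by_contra! hm
    nlinarith [pi_pos]
  have hm : m = 0 := by
    have : m < 1 := by exact_mod_cast hm1
    have : -1 < m := by exact_mod_cast hm2
    omega
  rw [e1, hm]
  simp

theorem arctan_add_arctan_le (x y : ℝ) : arctan x + arctan y ≤ arctan (x + y) + π / 2 := by
  wlog hxy : x ≤ y generalizing x y
  · rw [add_comm (arctan x), add_comm x]
    exact this y x (le_of_not_ge hxy)
  rcases le_or_gt 0 x with hx | hx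
  · have h1 : arctan y ≤ arctan (x + y) := arctan_mono (by linarith)
    have h2 := arctan_lt_pi_div_two x
    linarith
  · rcases le_or_gt 0 (x + y) with h | h
    · have h1 : 0 ≤ arctan (x + y) := arctan_nonneg.2 h
      have h2 := arctan_lt_pi_div_two y
      have h3 : arctan x < 0 := arctan_lt_zero.2 hx
      linarith
    · have h1 : arctan y ≤ -arctan x := by
        rw [← arctan_neg]
        exact arctan_mono (by linarith)
      have h2 := neg_pi_div_two_lt_arctan (x + y)
      linarith

/-- Merging two arctangents costs at most `π / 2`, and `card - 1` merges suffice. The truncated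
subtraction covers the empty sum. -/
theorem sum_arctan_le {ι : Type*} (s : Finset ι) (f : ι → ℝ) :
    ∑ i ∈ s, arctan (f i) ≤ arctan (∑ i ∈ s, f i) + (s.card - 1 : ℕ) * (π / 2) := by
  classical
  induction s using Finset.induction_on with
  | empty => simp
  | insert i s hi ih =>
    rw [Finset.sum_insert hi, Finset.sum_insert hi, Finset.card_insert_of_notMem hi,
      Nat.add_sub_cancel]
    rcases s.eq_empty_or_nonempty with rfl | hs
    · simp
    · have h1 : ((s.card - 1 : ℕ) : ℝ) = s.card - 1 := by
        rw [Nat.cast_sub hs.card_pos, Nat.cast_one]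
      rw [h1] at ih
      have := arctan_add_arctan_le (f i) (∑ i ∈ s, f i)
      linarith

end Phase

/-! ### Tuning the phases vertex by vertex. -/

section ChoiceOfPhases

variable {V E : Type*} {src tgt : E → V}

/-- The other end of an edge. -/
def oppositeEnd (a : E × Bool) : E × Bool := (a.1, !a.2)

theorem eq_or_eq_oppositeEnd {a b : E × Bool} (h : b.1 = a.1) : b = a ∨ b = oppositeEnd a := by
  obtain ⟨e, s⟩ := a
  obtain ⟨e', s'⟩ := b
  obtain rfl : e' = e := h
  cases s <;> cases s' <;> simp [oppositeEnd]

/-- A rooted spanning structure on a network: except possibly for the end `a₀`, at each vertex which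
has ends there is an end of an edge that leads to `a₀` or to a vertex of smaller rank. -/
def IsRanking (src tgt : E → V) (a₀ : E × Bool) (rank : V → ℕ) : Prop :=
  ∀ v, (∀ a, endVertex src tgt a = v → a = a₀) ∨ ∃ a, endVertex src tgt a = v ∧ a ≠ a₀ ∧
    (oppositeEnd a = a₀ ∨ rank (endVertex src tgt (oppositeEnd a)) < rank v)

/-- Reversal of an edge is an involution on phases, so either end may be prescribed. -/
theorem exists_endPhase_eq {N : ℕ} {η : E → ℝ} (hη : ∀ e, 0 < η e) (hηπ : ∀ e, η e < π)
    (b : E × Bool) {t : ℝ} (ht : IsPhase N (η b.1) t) : ∃ t', IsPhase N (η b.1) t' ∧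
      ∀ θ : E → ℝ, θ b.1 = t' → endPhase N η θ b = t := by
  obtain ⟨e, s⟩ := b
  cases s
  · exact ⟨t, ht, fun θ h => by simpa [endPhase] using h⟩
  · refine ⟨oppositePhase N (η e) t, ht.oppositePhase (hη e) (hηπ e), fun θ h => ?_⟩
    simp only [endPhase, if_true] at h ⊢
    rw [h, oppositePhase_oppositePhase (hη e) (hηπ e) ht]

theorem abs_endPhase_lt {N : ℕ} {η θ : E → ℝ} (hη : ∀ e, 0 < η e) (hηπ : ∀ e, η e < π)
    (hθ : ∀ e, IsPhase N (η e) (θ e)) (a : E × Bool) : |endPhase N η θ a| < π / 2 := by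
  unfold endPhase
  split_ifs
  · exact abs_oppositePhase_lt (hη _) (hηπ _) (hθ _)
  · exact (hθ _).1

theorem endPhase_congr {N : ℕ} {η θ θ' : E → ℝ} {a : E × Bool} (h : θ a.1 = θ' a.1) :
    endPhase N η θ a = endPhase N η θ' a := by
  simp only [endPhase, h]

section Degree

/-- The degree of a vertex of a network. -/
def networkDegree [Fintype E] [DecidableEq V] (src tgt : E → V) (v : V) : ℕ :=
  (Finset.univ.filter fun a : E × Bool => endVertex src tgt a = v).card

variable [Fintype V] [Fintype E] [DecidableEq V]

theorem sum_networkDegree : ∑ v, networkDegree src tgt v = 2 * Fintype.card E := by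
  unfold networkDegree
  rw [← Finset.card_eq_sum_card_fiberwise fun _ _ => Finset.mem_coe.2 (Finset.mem_univ _)]
  simp [mul_comm]

/-- Truncation replaces `-1` by `0` at each pendant vertex; this is where `p` enters the bound. -/
theorem sum_networkDegree_sub_two (hdeg : ∀ v, 0 < networkDegree src tgt v) :
    ∑ v, (networkDegree src tgt v - 2) + 2 * Fintype.card V =
      2 * Fintype.card E + (Finset.univ.filter fun v => networkDegree src tgt v = 1).card := by
  rw [← sum_networkDegree (src := src) (tgt := tgt), Finset.card_filter,
    ← Finset.sum_add_distrib, mul_comm, ← smul_eq_mul, ← Finset.card_univ, ← Finset.sum_const,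
    ← Finset.sum_add_distrib]
  refine Finset.sum_congr rfl fun v _ => ?_
  have := hdeg v
  split_ifs <;> omega

end Degree

variable [Fintype E] [DecidableEq V] [DecidableEq E]

/-- The ends of edges at the vertex `v`, except for `a₀`. -/
def endsAt (src tgt : E → V) (a₀ : E × Bool) (v : V) : Finset (E × Bool) :=
  {a | endVertex src tgt a = v ∧ a ≠ a₀}

theorem mem_endsAt {a₀ a : E × Bool} {v : V} :
    a ∈ endsAt src tgt a₀ v ↔ endVertex src tgt a = v ∧ a ≠ a₀ := by simp [endsAt]

variable [Fintype V]

theorem exists_phases {a₀ : E × Bool} {rank : V → ℕ} (hrank : IsRanking src tgt a₀ rank) {N : ℕ}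
    {η : E → ℝ} (hη : ∀ e, 0 < η e) (hηπ : ∀ e, η e < π) {ε : ℝ} (hε : 0 < ε) :
    ∃ θ : E → ℝ, (∀ e, IsPhase N (η e) (θ e)) ∧ ∀ v,
      0 ≤ ∑ a ∈ endsAt src tgt a₀ v, tan (endPhase N η θ a) ∧
      ∑ a ∈ endsAt src tgt a₀ v, endPhase N η θ a ≤
        ((endsAt src tgt a₀ v).card - 2 : ℕ) * (π / 2) + ε := by
  suffices H : ∀ S : Finset V, ∃ θ : E → ℝ, (∀ e, IsPhase N (η e) (θ e)) ∧ ∀ v ∈ S,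
      0 ≤ ∑ a ∈ endsAt src tgt a₀ v, tan (endPhase N η θ a) ∧
      ∑ a ∈ endsAt src tgt a₀ v, endPhase N η θ a ≤
        ((endsAt src tgt a₀ v).card - 2 : ℕ) * (π / 2) + ε by
    obtain ⟨θ, h1, h2⟩ := H Finset.univ
    exact ⟨θ, h1, fun v => h2 v (Finset.mem_univ v)⟩
  intro S
  -- Vertices are treated in order of decreasing rank. Retuning the chosen end at `v` disturbs only
  -- its opposite end, which is `a₀` or sits at a vertex not yet treated.
  induction S using Finset.induction_on_min_value rank with
  | empty =>
    choose θ _ hθ using fun e => exists_isPhase_mem_Ioo N (η e) (lo := -(π / 2)) (hi := π / 2)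
      (by linarith [pi_pos]) le_rfl le_rfl
    exact ⟨θ, hθ, by simp⟩
  | insert v S hv hmin ih =>
    obtain ⟨θ, hθ, hS⟩ := ih
    rcases hrank v with hnone | ⟨a, hav, haa₀, hopp⟩
    · refine ⟨θ, hθ, fun w hw => ?_⟩
      rcases Finset.mem_insert.1 hw with rfl | hw
      · have : endsAt src tgt a₀ w = ∅ :=
          Finset.eq_empty_of_forall_notMem fun a ha =>
            (mem_endsAt.1 ha).2 (hnone a (mem_endsAt.1 ha).1)
        simpa [this] using hε.le
      · exact hS w hw
    · set B := (endsAt src tgt a₀ v).erase a with hB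
      have ha : a ∈ endsAt src tgt a₀ v := mem_endsAt.2 ⟨hav, haa₀⟩
      set T := ∑ b ∈ B, tan (endPhase N η θ b) with hT
      have hlt := arctan_lt_pi_div_two (-T)
      -- `arctan (-T)` would make the tangent sum exactly zero; a slightly larger value is taken so
      -- that no node is a zero of the wave.
      obtain ⟨t, ⟨ht1, ht2⟩, ht⟩ := exists_isPhase_mem_Ioo N (η a.1) (lo := arctan (-T))
        (hi := min (arctan (-T) + ε) (π / 2)) (lt_min (by linarith) hlt)
        (neg_pi_div_two_lt_arctan _).le (min_le_right _ _)
      obtain ⟨t', ht', heq⟩ := exists_endPhase_eq hη hηπ a ht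
      have hne : ∀ b, b ≠ a → b ≠ a₀ → rank v ≤ rank (endVertex src tgt b) → b.1 ≠ a.1 := by
        intro b hba hba₀ hr h
        rcases eq_or_eq_oppositeEnd h with h | h
        · exact hba h
        · rcases hopp with h' | h'
          · exact hba₀ (h.trans h')
          · rw [← h] at h'
            omega
      have hphase : ∀ b, b ≠ a → b ≠ a₀ → rank v ≤ rank (endVertex src tgt b) →
          endPhase N η (Function.update θ a.1 t') b = endPhase N η θ b := fun b h1 h2 h3 =>
        endPhase_congr (Function.update_of_ne (hne b h1 h2 h3) _ _)
      refine ⟨Function.update θ a.1 t', fun e => ?_, fun w hw => ?_⟩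
      · rcases eq_or_ne e a.1 with rfl | he
        · rwa [Function.update_self]
        · rw [Function.update_of_ne he]
          exact hθ e
      · rcases Finset.mem_insert.1 hw with rfl | hw
        · have hBphase : ∀ b ∈ B, endPhase N η (Function.update θ a.1 t') b = endPhase N η θ b := by
            intro b hb
            obtain ⟨hba, hb'⟩ := Finset.mem_erase.1 hb
            obtain ⟨hbw, hba₀⟩ := mem_endsAt.1 hb'
            exact hphase b hba hba₀ (by rw [hbw])
          have hat := heq (Function.update θ a.1 t') (Function.update_self _ _ _)
          rw [← Finset.add_sum_erase _ _ ha, ← Finset.add_sum_erase _ _ ha, ← hB, hat,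
            Finset.sum_congr rfl hBphase,
            Finset.sum_congr rfl fun b hb => congrArg tan (hBphase b hb), ← hT]
          constructor
          · have h1 : tan (arctan (-T)) < tan t := tan_lt_tan_of_lt_of_lt_pi_div_two
              (neg_pi_div_two_lt_arctan _) (ht2.trans_le (min_le_right _ _)) ht1
            rw [tan_arctan] at h1
            linarith
          · have h1 : ∑ b ∈ B, endPhase N η θ b = ∑ b ∈ B, arctan (tan (endPhase N η θ b)) := by
              refine Finset.sum_congr rfl fun b _ => ?_
              have := abs_lt.1 (abs_endPhase_lt hη hηπ hθ b)
              rw [arctan_tan this.1 this.2]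
            -- The other ends contribute at most `arctan T` plus multiples of `π / 2`, and `arctan
            -- T` cancels against the tuned phase.
            have h2 := sum_arctan_le B fun b => tan (endPhase N η θ b)
            rw [← hT] at h2
            have h3 : B.card - 1 = (endsAt src tgt a₀ w).card - 2 := by
              rw [hB, Finset.card_erase_of_mem ha]
              omega
            rw [h3] at h2
            rw [h1]
            have h4 := ht2.trans_le (min_le_left _ _)
            rw [arctan_neg] at h4
            linarith
        · have : ∀ b ∈ endsAt src tgt a₀ w,
              endPhase N η (Function.update θ a.1 t') b = endPhase N η θ b := by
            intro b hb
            obtain ⟨hbw, hba₀⟩ := mem_endsAt.1 hb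
            refine hphase b ?_ hba₀ (by rw [hbw]; exact hmin w hw)
            rintro rfl
            exact hv (by rwa [← hav, hbw])
          rw [Finset.sum_congr rfl this, Finset.sum_congr rfl fun b hb => congrArg tan (this b hb)]
          exact hS w hw

theorem exists_nonpos_subspace_of_lt {M : ℕ} {a₀ : E × Bool} {rank : V → ℕ}
    (hrank : IsRanking src tgt a₀ rank) (hdeg : ∀ v, 0 < networkDegree src tgt v) {h : E → ℝ}
    (hh : ∀ e, 0 < h e) {K : ℝ} (hK0 : 0 < K) (hK : ∀ e, K * h e < π) (j : ℕ)
    (hj : π * (j - 1 + 2 * (Fintype.card E - Fintype.card V + 1) +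
        ((Finset.univ.filter fun v => networkDegree src tgt v = 1).card : ℝ) / 2) <
      K * ∑ e, (M + 1) * h e) :
    ∃ W : Submodule ℝ (EuclideanSpace ℝ (V ⊕ E × Fin M)),
      (∀ x ∈ W, inner ℝ (networkOp src tgt M h K x) x ≤ 0) ∧ j + 1 ≤ Module.finrank ℝ W := by
  set m := Fintype.card E
  set n := Fintype.card V with hn
  set p := (Finset.univ.filter fun v => networkDegree src tgt v = 1).card
  -- The slack in `hj`. Each of the `n` vertices may spend `δ / (n + 1)`, which in total is less
  -- than `δ`.
  set δ := K * (∑ e, (M + 1) * h e) - π * (j - 1 + 2 * (m - n + 1) + (p : ℝ) / 2) with hδ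
  have hδ0 : 0 < δ := sub_pos.2 hj
  obtain ⟨θ, hθ, hv⟩ := exists_phases hrank (N := M + 1) (η := fun e => K * h e)
    (fun e => mul_pos hK0 (hh e)) hK (ε := δ / (n + 1)) (by positivity)
  set A := endPhase (M + 1) (fun e => K * h e) θ with hA
  set Φ := ∑ e, signChanges (M + 1) (K * h e) (θ e) with hΦ
  have hsplit : ∀ (F : E × Bool → ℝ) v, ∑ a : E × Bool with endVertex src tgt a = v, F a =
      ∑ a ∈ endsAt src tgt a₀ v, F a + if endVertex src tgt a₀ = v then F a₀ else 0 := by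
    intro F v
    have h1 : endsAt src tgt a₀ v =
        (Finset.univ.filter fun a : E × Bool => endVertex src tgt a = v).erase a₀ := by
      ext a
      rw [mem_endsAt, Finset.mem_erase, Finset.mem_filter]
      simp [and_comm]
    split_ifs with h2
    · rw [h1, Finset.sum_erase_add _ _ (by simpa using h2)]
    · rw [h1, Finset.erase_eq_of_notMem (by simpa using h2), add_zero]
  -- The two end phases of an edge add up to `K` times its length minus `π` per sign change.
  have hsum : ∑ v, ∑ a ∈ endsAt src tgt a₀ v, A a + A a₀ =
      K * (∑ e, (M + 1) * h e) - π * Φ := by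
    have h1 : ∑ v, ∑ a : E × Bool with endVertex src tgt a = v, A a = ∑ a, A a :=
      Finset.sum_fiberwise _ _ _
    rw [Finset.sum_congr rfl fun v _ => hsplit A v, Finset.sum_add_distrib, Finset.sum_ite_eq,
      if_pos (Finset.mem_univ _)] at h1
    rw [h1, Fintype.sum_prod_type, hΦ, Nat.cast_sum, Finset.mul_sum, Finset.mul_sum,
      ← Finset.sum_sub_distrib]
    refine Finset.sum_congr rfl fun e _ => ?_
    rw [Fintype.sum_bool]
    simp only [hA, endPhase, if_true, Bool.false_eq_true, if_false, oppositePhase]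
    push_cast
    ring
  have hcard : ∀ v, (endsAt src tgt a₀ v).card ≤ networkDegree src tgt v := fun v =>
    Finset.card_le_card fun a ha => by simpa using (mem_endsAt.1 ha).1
  have hbound : ∑ v, ∑ a ∈ endsAt src tgt a₀ v, A a < (2 * m - 2 * n + p) * (π / 2) + δ := by
    have h1 : ∑ v, ∑ a ∈ endsAt src tgt a₀ v, A a ≤
        ∑ v : V, (((networkDegree src tgt v - 2 : ℕ) : ℝ) * (π / 2) + δ / (n + 1)) := by
      refine Finset.sum_le_sum fun v _ => (hv v).2.trans ?_
      have : (((endsAt src tgt a₀ v).card - 2 : ℕ) : ℝ) ≤ (networkDegree src tgt v - 2 : ℕ) := by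
        exact_mod_cast Nat.sub_le_sub_right (hcard v) 2
      gcongr
    have h2 : ((∑ v, (networkDegree src tgt v - 2) : ℕ) : ℝ) + 2 * n = 2 * m + p := by
      exact_mod_cast sum_networkDegree_sub_two hdeg
    rw [Finset.sum_add_distrib, ← Finset.sum_mul, ← Nat.cast_sum, Finset.sum_const,
      Finset.card_univ, nsmul_eq_mul, ← hn] at h1
    have h3 : (n : ℝ) * (δ / (n + 1)) < δ := by
      rw [mul_div_assoc', div_lt_iff₀ (by positivity)]
      linarith
    have h4 : ((∑ v, (networkDegree src tgt v - 2) : ℕ) : ℝ) = 2 * m - 2 * n + p := by linarith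
    rw [h4] at h1
    linarith
  have hΦ1 : π * (j + 1 + m - n) - A a₀ < π * Φ := by
    rw [hδ] at hbound
    linarith
  have hA0 := abs_lt.1 (abs_endPhase_lt (fun e => mul_pos hK0 (hh e)) hK hθ a₀)
  -- A nonnegative phase at `a₀` only helps the tangent sum, and being below `π / 2` it costs less
  -- than one sign change. A negative one may spoil its vertex, but then `hΦ1` yields an extra sign
  -- change that pays for the Dirichlet condition.
  rcases le_or_gt 0 (A a₀) with hpos | hneg
  · obtain ⟨W, hW, hWd⟩ := exists_nonpos_subspace (src := src) (tgt := tgt) (M := M) hh hK0 hK hθ ∅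
      fun v _ => by
        rw [hsplit (fun a => tan (A a))]
        refine add_nonneg (hv v).1 ?_
        split_ifs
        · exact tan_nonneg_of_nonneg_of_le_pi_div_two hpos hA0.2.le
        · exact le_rfl
    refine ⟨W, hW, ?_⟩
    have h1 : (j : ℝ) + m - n < Φ := by
      have : A a₀ < π / 2 := hA0.2
      have h2 : π * (j + m - n) < π * Φ := by linarith [pi_pos]
      exact lt_of_mul_lt_mul_left h2 pi_pos.le
    have h2 : j + m < n + Φ := by
      have : (j : ℝ) + m < n + Φ := by linarith
      exact_mod_cast this
    rw [Finset.card_empty] at hWd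
    omega
  · obtain ⟨W, hW, hWd⟩ := exists_nonpos_subspace (src := src) (tgt := tgt) (M := M) hh hK0 hK hθ
      {endVertex src tgt a₀} fun v hv0 => by
        rw [hsplit (fun a => tan (A a)), if_neg (fun h => hv0 (Finset.mem_singleton.2 h.symm)),
          add_zero]
        exact (hv v).1
    refine ⟨W, hW, ?_⟩
    have h1 : (j : ℝ) + 1 + m - n < Φ := by
      have h2 : π * (j + 1 + m - n) < π * Φ := by linarith
      exact lt_of_mul_lt_mul_left h2 pi_pos.le
    have h2 : j + 1 + m < n + Φ := by
      have : (j : ℝ) + 1 + m < n + Φ := by linarith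
      exact_mod_cast this
    rw [Finset.card_singleton] at hWd
    omega

end ChoiceOfPhases

end

noncomputable section

/-! ### Rooted spanning structures. -/

section Ranking

variable {V E : Type*} {src tgt : E → V}

/-- `u` and `v` are joined by an edge in `F`. -/
def JoinedBy (src tgt : E → V) (F : Set E) (u v : V) : Prop :=
  ∃ a : E × Bool, a.1 ∈ F ∧ endVertex src tgt (oppositeEnd a) = u ∧ endVertex src tgt a = v

theorem oppositeEnd_oppositeEnd (a : E × Bool) : oppositeEnd (oppositeEnd a) = a := by
  simp [oppositeEnd]

theorem JoinedBy.symm {F : Set E} {u v : V} (h : JoinedBy src tgt F u v) :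
    JoinedBy src tgt F v u := by
  obtain ⟨a, ha, hu, hv⟩ := h
  exact ⟨oppositeEnd a, ha, by rwa [oppositeEnd_oppositeEnd], hu⟩

theorem exists_rank_of_reflTransGen {F : Set E} {w : V}
    (h : ∀ v, Relation.ReflTransGen (JoinedBy src tgt F) w v) :
    ∃ rank : V → ℕ, ∀ v, v ≠ w → ∃ a : E × Bool, a.1 ∈ F ∧ endVertex src tgt a = v ∧
      rank (endVertex src tgt (oppositeEnd a)) < rank v := by
  classical
  -- `P n v` says that a walk of length `n` leads from `w` to `v`; the rank is the distance from
  -- `w`.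
  let P : ℕ → V → Prop := fun n => Nat.rec (motive := fun _ => V → Prop) (fun v => v = w)
    (fun _ Q v => ∃ u, Q u ∧ JoinedBy src tgt F u v) n
  have hP : ∀ v, ∃ n, P n v := by
    intro v
    induction h v with
    | refl => exact ⟨0, rfl⟩
    | tail _ hbc ih =>
      obtain ⟨n, hn⟩ := ih
      exact ⟨n + 1, _, hn, hbc⟩
  refine ⟨fun v => Nat.find (hP v), fun v hv => ?_⟩
  have hspec := Nat.find_spec (hP v)
  rcases hn : Nat.find (hP v) with _ | n
  · rw [hn] at hspec
    exact absurd hspec hv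
  · rw [hn] at hspec
    obtain ⟨u, hu, a, haF, hau, hav⟩ := hspec
    refine ⟨a, haF, hav, ?_⟩
    simp only [hau, hn]
    exact Nat.lt_succ_of_le (Nat.find_min' (hP u) hu)

variable [Fintype E] [DecidableEq V]

theorem networkDegree_pos [Nonempty E]
    (hconn : ∀ u v, Relation.ReflTransGen (JoinedBy src tgt Set.univ) u v) (v : V) :
    0 < networkDegree src tgt v := by
  obtain ⟨e⟩ := ‹Nonempty E›
  suffices ∃ a : E × Bool, endVertex src tgt a = v by
    obtain ⟨a, ha⟩ := this
    exact Finset.card_pos.2 ⟨a, by simpa using ha⟩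
  rcases Relation.ReflTransGen.cases_tail (hconn (src e) v) with h | ⟨u, _, a, _, _, ha⟩
  · exact ⟨(e, false), by simp [endVertex, h]⟩
  · exact ⟨a, ha⟩

/-- With a pendant vertex as root, `a₀` is its only end. Otherwise all degrees are at least two, so
`n ≤ m` and some edge `e₀` can be removed without disconnecting; one end of `e₀` serves its vertex
as the tuned end of the root, the other is `a₀`. -/
theorem exists_isRanking [Fintype V] [Nonempty E]
    (hconn : ∀ u v, Relation.ReflTransGen (JoinedBy src tgt Set.univ) u v) :
    ∃ a₀ rank, IsRanking src tgt a₀ rank := by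
  classical
  by_cases hleaf : ∃ r, networkDegree src tgt r = 1
  · obtain ⟨r, hr⟩ := hleaf
    obtain ⟨a₀, ha₀⟩ := Finset.card_eq_one.1 hr
    have hmem : ∀ a, endVertex src tgt a = r ↔ a = a₀ := fun a => by
      rw [← Finset.mem_singleton (a := a₀), ← ha₀]; simp
    obtain ⟨rank, hrank⟩ := exists_rank_of_reflTransGen (hconn r)
    refine ⟨a₀, rank, fun v => ?_⟩
    rcases eq_or_ne v r with rfl | hv
    · exact .inl fun a ha => (hmem a).1 ha
    · obtain ⟨a, -, hav, ha⟩ := hrank v hv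
      refine .inr ⟨a, hav, fun h => hv ?_, .inr ha⟩
      rw [← hav, (hmem a).2 h]
  · have hdeg : ∀ v, 2 ≤ networkDegree src tgt v := fun v => by
      have h1 := networkDegree_pos hconn v
      have h2 : networkDegree src tgt v ≠ 1 := fun h => hleaf ⟨v, h⟩
      omega
    have hcard : Fintype.card V ≤ Fintype.card E := by
      have h1 := Finset.sum_le_sum fun v (_ : v ∈ Finset.univ) => hdeg v
      rw [sum_networkDegree, Finset.sum_const, Finset.card_univ, smul_eq_mul] at h1
      omega
    obtain ⟨e⟩ := ‹Nonempty E›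
    obtain ⟨rank₁, h₁⟩ := exists_rank_of_reflTransGen (hconn (src e))
    choose! par hpar using h₁
    -- The parent edges number at most `n - 1 < m`, so some edge is not a parent edge.
    obtain ⟨e₀, he₀⟩ : ∃ e₀, e₀ ∉ (Finset.univ.erase (src e)).image fun v => (par v).1 := by
      by_contra! hall
      have h1 := Finset.card_le_card fun e₀ (_ : e₀ ∈ (Finset.univ : Finset E)) => hall e₀
      have h2 := h1.trans Finset.card_image_le
      rw [Finset.card_erase_of_mem (Finset.mem_univ _), Finset.card_univ, Finset.card_univ] at h2
      have h3 : 0 < Fintype.card V := Fintype.card_pos_iff.2 ⟨src e⟩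
      omega
    have hpar₀ : ∀ v, v ≠ src e → (par v).1 ≠ e₀ := fun v hv h =>
      he₀ (Finset.mem_image.2 ⟨v, by simpa using hv, h⟩)
    have hreach : ∀ n v, rank₁ v = n →
        Relation.ReflTransGen (JoinedBy src tgt {e₀}ᶜ) (src e) v := by
      intro n
      induction n using Nat.strong_induction_on with
      | _ n ih =>
        intro v hvn
        rcases eq_or_ne v (src e) with rfl | hv
        · exact .refl
        · obtain ⟨-, h2, h3⟩ := hpar v hv
          exact (ih _ (hvn ▸ h3) _ rfl).tail ⟨par v, hpar₀ v hv, rfl, h2⟩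
    have : Std.Symm (JoinedBy src tgt {e₀}ᶜ) := ⟨fun _ _ h => h.symm⟩
    -- Ranks are taken afresh, from an end of `e₀` and avoiding `e₀`.
    obtain ⟨rank, hrank⟩ := exists_rank_of_reflTransGen (src := src) (tgt := tgt) (F := {e₀}ᶜ)
      (w := src e₀) fun v => (Std.Symm.symm _ _ (hreach _ (src e₀) rfl)).trans (hreach _ v rfl)
    refine ⟨(e₀, true), rank, fun v => .inr ?_⟩
    rcases eq_or_ne v (src e₀) with rfl | hv
    · exact ⟨(e₀, false), by simp [endVertex], by simp, .inl (by simp [oppositeEnd])⟩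
    · obtain ⟨a, haF, hav, ha⟩ := hrank v hv
      refine ⟨a, hav, fun h => haF ?_, .inr ha⟩
      rw [h]
      rfl

end Ranking

/-! ### Transfer to the graph and conclusion. -/

namespace Graph

variable {α β : Type*} {G : Graph α β}

theorem IsConnected.reflTransGen_joinedBy (hG : G.IsConnected) (u v : V(G)) :
    Relation.ReflTransGen (JoinedBy G.sourceVertex G.targetVertex Set.univ) u v := by
  have key : ∀ {x y : α} (hx : x ∈ V(G)), Relation.ReflTransGen G.Adj x y → ∃ hy : y ∈ V(G),
      Relation.ReflTransGen (JoinedBy G.sourceVertex G.targetVertex Set.univ) ⟨x, hx⟩ ⟨y, hy⟩ := by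
    intro x y hx h
    induction h with
    | refl => exact ⟨hx, .refl⟩
    | tail _ hbc ih =>
      obtain ⟨hb, ih⟩ := ih
      refine ⟨hbc.right_mem, ih.tail ?_⟩
      obtain ⟨e, he⟩ := hbc
      rcases he.eq_and_eq_or_eq_and_eq (G.isLink_source_target ⟨e, he.edge_mem⟩) with
        ⟨h1, h2⟩ | ⟨h1, h2⟩
      · exact ⟨(⟨e, he.edge_mem⟩, true), trivial, Subtype.ext h1.symm, Subtype.ext h2.symm⟩
      · exact ⟨(⟨e, he.edge_mem⟩, false), trivial, Subtype.ext h1.symm, Subtype.ext h2.symm⟩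
  exact (key u.2 (hG.2 u u.2 v v.2)).2

variable [Fintype E(G)] [DecidableEq V(G)] [DecidableEq E(G)]

theorem networkDegree_eq_vertexDegree (v : V(G)) :
    networkDegree G.sourceVertex G.targetVertex v = G.vertexDegree v := by
  have hs : ∀ e, G.sourceVertex e = v ↔ G.source e = v := fun e => Subtype.ext_iff
  have ht : ∀ e, G.targetVertex e = v ↔ G.target e = v := fun e => Subtype.ext_iff
  have h1 : networkDegree G.sourceVertex G.targetVertex v =
      (Finset.univ.filter fun e => G.sourceVertex e = v).card +
        (Finset.univ.filter fun e => G.targetVertex e = v).card := by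
    unfold networkDegree
    rw [Finset.card_filter, Finset.card_filter, Finset.card_filter, Fintype.sum_prod_type]
    simp only [Fintype.sum_bool, endVertex, if_true,
      Bool.false_eq_true, if_false, Finset.sum_add_distrib]
    rw [add_comm]
  have h2 : G.incidenceSet v = Subtype.val ''
      (((Finset.univ.filter fun e => G.sourceVertex e = v) ∪
        Finset.univ.filter fun e => G.targetVertex e = v : Finset E(G)) : Set E(G)) := by
    ext e
    simp only [mem_incidenceSet, Finset.coe_union, Finset.coe_filter, Finset.mem_univ, true_and,
      Set.mem_image, Set.mem_union, Set.mem_ofPred_eq, hs, ht, Subtype.exists, exists_and_right,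
      exists_eq_right]
    constructor
    · intro h
      refine ⟨h.edge_mem, ?_⟩
      rcases h.eq_or_eq_of_isLink (G.isLink_source_target ⟨e, h.edge_mem⟩) with h' | h'
      · exact .inl h'.symm
      · exact .inr h'.symm
    · rintro ⟨he, h | h⟩
      · exact h ▸ (G.isLink_source_target ⟨e, he⟩).inc_left
      · exact h ▸ (G.isLink_source_target ⟨e, he⟩).inc_right
  have h3 : G.loopSet v = Subtype.val ''
      (((Finset.univ.filter fun e => G.sourceVertex e = v) ∩
        Finset.univ.filter fun e => G.targetVertex e = v : Finset E(G)) : Set E(G)) := by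
    ext e
    simp only [mem_loopSet, Finset.coe_inter, Finset.coe_filter, Finset.mem_univ, true_and,
      Set.mem_image, Set.mem_inter_iff, Set.mem_ofPred_eq, hs, ht, Subtype.exists,
      exists_and_right, exists_eq_right]
    constructor
    · intro h
      refine ⟨h.edge_mem, ?_⟩
      rcases h.eq_and_eq_or_eq_and_eq (G.isLink_source_target ⟨e, h.edge_mem⟩) with h' | h'
      · exact ⟨h'.1.symm, h'.2.symm⟩
      · exact ⟨h'.2.symm, h'.1.symm⟩
    · rintro ⟨he, h, h'⟩
      have := G.isLink_source_target ⟨e, he⟩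
      rwa [h, h'] at this
  unfold vertexDegree
  rw [h1, h2, h3, Set.ncard_image_of_injective _ Subtype.val_injective,
    Set.ncard_image_of_injective _ Subtype.val_injective, Set.ncard_coe_finset,
    Set.ncard_coe_finset, Finset.card_union_add_card_inter]

variable [Fintype V(G)]

theorem card_networkDegree_eq_one :
    (Finset.univ.filter fun v => networkDegree G.sourceVertex G.targetVertex v = 1).card =
      G.numPendant := by
  have : {v ∈ V(G) | G.vertexDegree v = 1} = Subtype.val '' ((Finset.univ.filter fun v =>
      networkDegree G.sourceVertex G.targetVertex v = 1 : Finset V(G)) : Set V(G)) := by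
    ext v
    simp [networkDegree_eq_vertexDegree, and_comm]
  unfold numPendant
  rw [this, Set.ncard_image_of_injective _ Subtype.val_injective, Set.ncard_coe_finset]

theorem hasEigenvaluesLE_of_lt (hconn : G.IsConnected) [Nonempty E(G)] {ℓ : E(G) → ℝ}
    (hℓ : G.IsMetric ℓ) {K : ℝ} (hK0 : 0 < K) (j : ℕ)
    (hj : Real.pi * (j - 1 + 2 * G.betti + (G.numPendant : ℝ) / 2) < K * G.totalLength ℓ) :
    G.HasEigenvaluesLE ℓ (j + 1) (K ^ 2) := by
  -- Fine enough for `K * h e < π`, so `scaledSin k (h e)` never vanishes for `0 ≤ k ≤ K`.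
  obtain ⟨M, hM⟩ := exists_nat_gt (K * G.totalLength ℓ / Real.pi)
  have hM1 : (0 : ℝ) < M + 1 := by positivity
  have hℓh : ∀ e, ℓ e = (M + 1) * (ℓ e / (M + 1)) := fun e => by field_simp
  have hh : ∀ e, 0 < ℓ e / (M + 1) := fun e => div_pos (hℓ e) hM1
  have hK : ∀ e, K * (ℓ e / (M + 1)) < Real.pi := by
    intro e
    have h1 : ℓ e ≤ G.totalLength ℓ :=
      Finset.single_le_sum (f := ℓ) (fun e _ => (hℓ e).le) (Finset.mem_univ e)
    have h2 : K * ℓ e ≤ K * G.totalLength ℓ := mul_le_mul_of_nonneg_left h1 hK0.le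
    rw [div_lt_iff₀ Real.pi_pos] at hM
    rw [mul_div_assoc', div_lt_iff₀ hM1]
    nlinarith [Real.pi_pos]
  obtain ⟨a₀, rank, hrank⟩ := exists_isRanking hconn.reflTransGen_joinedBy
  have hdeg := networkDegree_pos hconn.reflTransGen_joinedBy
  obtain ⟨W, hW, hWd⟩ := exists_nonpos_subspace_of_lt (M := M) hrank hdeg hh hK0 hK j (by
    rw [card_networkDegree_eq_one, ← Finset.sum_congr rfl fun e _ => hℓh e]
    change _ < K * G.totalLength ℓ
    convert hj using 4
    rw [betti, ← Nat.card_coe_set_eq, ← Nat.card_coe_set_eq, Nat.card_eq_fintype_card,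
      Nat.card_eq_fintype_card]
    push_cast
    ring)
  refine hasEigenvaluesLE_of_nonpos_subspace hh hℓh hK0.le hK (fun v => ?_) W hW hWd
  obtain ⟨⟨e, b⟩, ha⟩ := Finset.card_pos.1 (hdeg v)
  have ha' := (Finset.mem_filter.1 ha).2
  refine ⟨e, ?_⟩
  cases b
  · exact .inl ha'
  · exact .inr ha'

end Graph

end

theorem theorem1p2 {α β : Type*} (G : Graph α β) [Finite V(G)] [Fintype E(G)]
    (hconn : G.IsConnected) (hedge : E(G).Nonempty) (j : ℕ) (hj : 1 ≤ j) :
    G.maxEigenvalue j ≤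
      ((((j : ℝ) - 1 + 2 * (G.betti : ℝ) + (G.numPendant : ℝ) / 2) ^ 2 * Real.pi ^ 2 : ℝ) :
        EReal) := by
  classical
  have : Fintype V(G) := Fintype.ofFinite _
  have : Nonempty E(G) := hedge.to_subtype
  refine sInf_le fun ℓ hℓ => ?_
  have hL : 0 < G.totalLength ℓ :=
    Finset.sum_pos (fun e _ => hℓ e) Finset.univ_nonempty
  rw [← EReal.coe_div]
  -- Any real `r` strictly above the bound is tested, with `K = √r`; strictness supplies the slack
  -- for generic phases.
  refine EReal.le_of_forall_lt_iff_le.1 fun r hr => sInf_le ⟨r, rfl, ?_⟩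
  have hr' := EReal.coe_lt_coe_iff.1 hr
  have hr0 : 0 < r := lt_of_le_of_lt (by positivity) hr'
  rw [← Real.sq_sqrt hr0.le]
  refine Graph.hasEigenvaluesLE_of_lt hconn hℓ (Real.sqrt_pos.2 hr0) j ?_
  rw [div_lt_iff₀ (by positivity)] at hr'
  refine lt_of_pow_lt_pow_left₀ 2 (by positivity) ?_
  rw [mul_pow, mul_pow, Real.sq_sqrt hr0.le]
  linarith
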